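/- Let $\mathcal X\subset\mathbb R$ be a Borel set (for instance an interval) with the metric $d(x,y)=|x-y|$, let $f:\mathcal X\to\mathcal X$ be measurable, and let $\mu$ be an $f$-invariant ergodic probability measure on $\mathcal X$ that is absolutely continuous with respect to Lebesgue measure, $d\mu=\rho\,dx$. For $\varphi:\mathcal X\to\mathbb R$ put $\|\varphi\|_{\mathrm{BV}}=\mathrm{var}_{\mathcal X}(\varphi)+\sup_{\mathcal X}|\varphi|$, where $\mathrm{var}_{\mathcal X}$ is the total variation on $\mathcal X$, and write $\varphi\in\mathrm{BV}$ if this is finite. Suppose that $(\mathcal X,f,\mu)$ is hyperbolic recurrent, that is, $\rho\in\mathrm{BV}$ and: (A1) there are $C,\theta>0$ such that for all $\varphi_1\in\mathrm{BV}$, $\varphi_2\in L^1(\mu)$ and $j\ge 0$, $$\left|\int\varphi_1\cdot\varphi_2\circ f^j\,d\mu-\int\varphi_1\,d\mu\int\varphi_2\,d\mu\right|\le Ce^{-\theta j}\,\|\varphi_1\|_{\mathrm{BV}}\,\|\varphi_2\|_{L^1(\mu)};$$ (A2) for every $a>0$ and every sequence $(r_n)$ such that, for some $c>1$, $c^{-1}\le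 r_n/n^{-a}\le c$ for all large $n$, there are $\beta_0\in(0,1)$ and $C>0$ such that for all sufficiently large $n$ and all integers $1\le j\le(\log n)^2$, $$\mu\{x\in\mathcal X: d(x,f^jx)\le r_n\}\le C\,r_n^{\beta_0}.$$ Let $\tau>0$, $r_n=\tau/(2n)$ and $R_n(r,x)=\#\{1\le j\le n: d(f^jx,x)\le r\}$. Then for every integer $k\ge1$, $$\lim_{n\to\infty}\mu\{x\in\mathcal X: R_n(r_n,x)=k\}=\int_{\mathcal X}\frac{\tau^k\rho(x)^{k+1}}{k!}e^{-\rho(x)\tau}\,dx.$$ -/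

import Mathlib

open MeasureTheory Filter Topology
open scoped ENNReal

noncomputable section

/-- The `BV` norm `var φ + sup |φ|` of a function on a subset `X` of the line, with values in
`[0, ∞]`; both terms are pointwise (no almost-everywhere identification). -/
def bvNorm {X : Set ℝ} (φ : X → ℝ) : ℝ≥0∞ :=
  eVariationOn φ Set.univ + ⨆ x, ‖φ x‖ₑ

/-- Functions of bounded variation: those with finite `BV` norm. -/
def IsBV {X : Set ℝ} (φ : X → ℝ) : Prop :=
  bvNorm φ < ∞

/-- The correlation `|∫ φ₁ · φ₂ ∘ f^j dμ - ∫ φ₁ dμ ∫ φ₂ dμ|`. -/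
def correlation {X : Set ℝ} (f : X → X) (μ : Measure X) (j : ℕ) (φ₁ φ₂ : X → ℝ) : ℝ :=
  |(∫ x, φ₁ x * φ₂ (f^[j] x) ∂μ) - (∫ x, φ₁ x ∂μ) * (∫ x, φ₂ x ∂μ)|

/-- Decay of correlations in `BV` versus `L¹(μ)` with rate function `Θ`. -/
def HasDecayOfCorrelations {X : Set ℝ} (f : X → X) (μ : Measure X) (Θ : ℕ → ℝ) : Prop :=
  Tendsto Θ atTop (𝓝 0) ∧
    ∀ φ₁ φ₂ : X → ℝ, IsBV φ₁ → Integrable φ₂ μ → ∀ j : ℕ,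
      correlation f μ j φ₁ φ₂ ≤ Θ j * (bvNorm φ₁).toReal * ∫ x, |φ₂ x| ∂μ

/-- Exponential decay of correlations in `BV` versus `L¹(μ)`. -/
def HasExponentialDecay {X : Set ℝ} (f : X → X) (μ : Measure X) : Prop :=
  ∃ C > 0, ∃ θ > 0, HasDecayOfCorrelations f μ (fun j => C * Real.exp (-θ * j))

/-- The set `E_j(r)` of points with `d(x, f^j x) ≤ r`. -/
def closeReturnSet {X : Set ℝ} (f : X → X) (j : ℕ) (r : ℝ) : Set X :=
  {x | dist x (f^[j] x) ≤ r}

/-- `a_n ≈ b_n`: the ratio `a_n / b_n` is in `[c⁻¹, c]` for some `c > 1` and all large `n`. -/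
def SeqComparable (a b : ℕ → ℝ) : Prop :=
  ∃ c > 1, ∀ᶠ n in atTop, a n / b n ∈ Set.Icc c⁻¹ c

/-- The short-return bound: along every sequence `r_n ≈ n^(-a)`, `a > 0`, the sets `E_j(r_n)`
with `1 ≤ j ≤ (log n)²` have measure at most `C r_n^β`, for some `β ∈ (0,1)` and `C > 0` that do
not depend on `j` and `n`. -/
def ShortReturnBound {X : Set ℝ} (f : X → X) (μ : Measure X) : Prop :=
  ∀ (a : ℝ) (r : ℕ → ℝ), 0 < a → SeqComparable r (fun n => (n : ℝ) ^ (-a)) →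
    ∃ β ∈ Set.Ioo (0 : ℝ) 1, ∃ C > 0, ∀ᶠ n : ℕ in atTop, ∀ j : ℕ, 1 ≤ j →
      (j : ℝ) ≤ Real.log n ^ 2 → μ.real (closeReturnSet f j (r n)) ≤ C * r n ^ β

/-- Lebesgue measure on a (measurable) subset `X` of the line: `A ↦ Leb(A)` for `A ⊆ X`. -/
def lebesgueOn (X : Set ℝ) : Measure X :=
  (volume : Measure ℝ).comap Subtype.val

/-- `ρ` is a density of `μ` with respect to Lebesgue measure on `X`. -/
structure IsLebesgueDensity {X : Set ℝ} (μ : Measure X) (ρ : X → ℝ) : Prop where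
  measurable : Measurable ρ
  nonneg : ∀ x, 0 ≤ ρ x
  eq_withDensity : μ = (lebesgueOn X).withDensity (fun x => ENNReal.ofReal (ρ x))

/-- A hyperbolic recurrent system `(X, f, μ)` with invariant density `ρ`. Mathlib's `Ergodic`
contains that `f` is measurable and preserves `μ`. -/
structure HyperbolicRecurrent {X : Set ℝ} (f : X → X) (μ : Measure X) (ρ : X → ℝ) : Prop where
  isProbabilityMeasure : IsProbabilityMeasure μ
  ergodic : Ergodic f μ
  density : IsLebesgueDensity μ ρ
  density_bv : IsBV ρ
  decay : HasExponentialDecay f μ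
  shortReturns : ShortReturnBound f μ

/-- `R_n(r, x)`, the number of `1 ≤ j ≤ n` with `d(f^j x, x) ≤ r`. -/
def recurrenceCount {X : Set ℝ} (f : X → X) (n : ℕ) (r : ℝ) (x : X) : ℕ :=
  ((Finset.Icc 1 n).filter (fun j => dist (f^[j] x) x ≤ r)).card

end

/-! The proof is the method of factorial moments. Write `g` for the gap `logGap n`, about `(log
n)²`, and `N` for the number of returns at times in `[g, n]`. The aim is that the mean of `N.choose
m` tends to `∫ (τρ)^m dμ / m!` for every `m ≥ 1`; since `τρ` is bounded, the Bonferroni inequalities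
then give the mixed Poisson law (`tendsto_measureReal_eq_of_factorialMoments`). Passing from `dμ` to
`ρ dx` supplies the extra factor `ρ`.

The mean of `N.choose m` is a sum over sets of `m` times. Take first the `g`-separated sets.
Returning near `x` is a condition on a target that moves with `x`, so the line is cut into cells of
length `τ/(2n²)`: inside one initial cell the target is, up to one cell, a fixed window of cells.
Indicators of windows have BV norm at most 3, so decay of correlations makes separated hits of the
window independent up to `η = C exp(-θ g)`, smaller than any power of `n`. Summing over initial
cells costs only a factor `2w + 1` with `w ≤ n`, as each point lies in `2w + 1` windows
(`abs_measureReal_cell_returns_sub_integral_le`). Lebesgue differentiation then gives probability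
about `n^(-m) ∫ (τρ)^m dμ`, and there are about `n^m / m!` separated sets.

A set that is not separated contains times `i` and `i + l` with `l < g`. Then `f^i x` makes a short
return, and decorrelation combined with (A2) bounds the probability of such a pair by a constant
times `n^(-1-β)`. The event `B` that some close pair occurs thus has measure `O(g n^(-β))`. The
number of clustered sets of hits is not bounded, but it is controlled by moments of `N`, which are
polylogarithmic: within a residue class modulo `g` all times are separated
(`integral_hitCount_pow_le`, `sum_clusteredSets_le`). Times before `g` are discarded by (A2) alone.
-/

/-- A finite set of times any two of which are at distance at least `g`. -/
def SeparatedBy (g : ℕ) (s : Finset ℕ) : Prop :=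
  ∀ i ∈ s, ∀ j ∈ s, i < j → i + g ≤ j

/-- The set `A` decorrelates, with relative error `η`, from every event that happens at least
`g` steps later. -/
def DecorrelatesAfter {Ω : Type*} [MeasurableSpace Ω] (f : Ω → Ω) (μ : Measure Ω) (g : ℕ) (η : ℝ)
    (A : Set Ω) : Prop :=
  ∀ W : Set Ω, MeasurableSet W → ∀ j : ℕ, g ≤ j →
    |μ.real (A ∩ f^[j] ⁻¹' W) - μ.real A * μ.real W| ≤ η * μ.real W

/-! ### Approximate independence of hits at separated times -/

section Mixing

variable {Ω : Type*} [MeasurableSpace Ω] {f : Ω → Ω} {μ : Measure Ω} {g : ℕ} {η : ℝ}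

lemma SeparatedBy.mono {s t : Finset ℕ} (h : SeparatedBy g t) (hst : s ⊆ t) : SeparatedBy g s :=
  fun i hi j hj => h i (hst hi) j (hst hj)

lemma measurableSet_forall_iterate_mem (hf : Measurable f) {A : Set Ω} (hA : MeasurableSet A)
    (s : Finset ℕ) (e : ℕ → ℕ) : MeasurableSet {x | ∀ j ∈ s, f^[e j] x ∈ A} := by
  have : {x | ∀ j ∈ s, f^[e j] x ∈ A} = ⋂ j ∈ s, f^[e j] ⁻¹' A := by ext; simp
  rw [this]
  exact Finset.measurableSet_biInter _ fun j _ => hf.iterate _ hA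

/-- Peeling off the earliest of several separated events. -/
lemma DecorrelatesAfter.peel (hf : MeasurePreserving f μ μ) {A J : Set Ω} (hA : MeasurableSet A)
    (hJ : MeasurableSet J) (hmix : DecorrelatesAfter f μ g η J) (a : ℕ) (s : Finset ℕ)
    (hs : ∀ j ∈ s, a + g ≤ j) :
    |μ.real (f^[a] ⁻¹' J ∩ {x | ∀ j ∈ s, f^[j] x ∈ A})
      - μ.real J * μ.real {x | ∀ j ∈ s, f^[j] x ∈ A}|
      ≤ η * μ.real {x | ∀ j ∈ s, f^[j] x ∈ A} := by
  -- Every time in `s` is at least `a + g`, so the truncated subtraction is exact. Invariance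
  -- removes the shift by `a`, leaving `J` and an event `g` steps later.
  set W : Set Ω := {y | ∀ j ∈ s, f^[j - (a + g)] y ∈ A} with hW
  have hWm : MeasurableSet W := measurableSet_forall_iterate_mem hf.measurable hA s _
  have h1 : {x | ∀ j ∈ s, f^[j] x ∈ A} = f^[a] ⁻¹' (f^[g] ⁻¹' W) := by
    ext x
    simp only [hW, Set.mem_ofPred_eq, Set.mem_preimage, ← Function.iterate_add_apply]
    refine forall₂_congr fun j hj => ?_
    have := hs j hj
    rw [show j - (a + g) + (g + a) = j by omega]
  have hgW : MeasurableSet (f^[g] ⁻¹' W) := hf.measurable.iterate _ hWm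
  have h2 : μ.real {x | ∀ j ∈ s, f^[j] x ∈ A} = μ.real W := by
    rw [h1, (hf.iterate a).measureReal_preimage hgW.nullMeasurableSet,
      (hf.iterate g).measureReal_preimage hWm.nullMeasurableSet]
  rw [h2, h1, ← Set.preimage_inter,
    (hf.iterate a).measureReal_preimage (hJ.inter hgW).nullMeasurableSet]
  exact hmix W hWm g le_rfl

variable [IsProbabilityMeasure μ]

lemma measureReal_forall_iterate_mem_le (hf : MeasurePreserving f μ μ) {A : Set Ω}
    (hA : MeasurableSet A) {s : Finset ℕ} (hs : s.Nonempty) :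
    μ.real {x | ∀ j ∈ s, f^[j] x ∈ A} ≤ μ.real A := by
  obtain ⟨j, hj⟩ := hs
  rw [← (hf.iterate j).measureReal_preimage hA.nullMeasurableSet]
  exact measureReal_mono fun x hx => hx j hj

/-- Induction on the earliest time, removed by `DecorrelatesAfter.peel`. A step costs `η * μ.real A`
and not merely `η`, because the later event has measure at most `μ.real A`; this factor keeps the
errors summable over infinitely many cells. -/
lemma abs_measureReal_forall_iterate_mem_sub_pow_le (hf : MeasurePreserving f μ μ) {A : Set Ω}
    (hA : MeasurableSet A) (hη : 0 ≤ η) (hmix : DecorrelatesAfter f μ g η A) (s : Finset ℕ) :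
    s.Nonempty → SeparatedBy g s →
      |μ.real {x | ∀ j ∈ s, f^[j] x ∈ A} - μ.real A ^ s.card| ≤ s.card * (η * μ.real A) := by
  induction s using Finset.induction_on_min with
  | empty => simp
  | insert a s ha ih =>
    intro _ hsep
    have has : a ∉ s := fun h => (ha a h).false
    have hset : {x | ∀ j ∈ insert a s, f^[j] x ∈ A}
        = f^[a] ⁻¹' A ∩ {x | ∀ j ∈ s, f^[j] x ∈ A} := by ext; simp
    have hp0 : 0 ≤ μ.real A := measureReal_nonneg
    have hp1 : μ.real A ≤ 1 := measureReal_le_one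
    rcases s.eq_empty_or_nonempty with rfl | hne
    · have := (hf.iterate a).measureReal_preimage hA.nullMeasurableSet
      simp only [insert_empty_eq, Finset.mem_singleton, forall_eq, Finset.card_singleton, pow_one]
      rw [show {x | f^[a] x ∈ A} = f^[a] ⁻¹' A from rfl, this]
      simp only [sub_self, abs_zero]
      positivity
    · have h1 := hmix.peel hf hA hA a s fun j hj =>
        hsep a (by simp) j (by simp [hj]) (ha j hj)
      have h2 := ih hne (hsep.mono (Finset.subset_insert _ _))
      have h3 := measureReal_forall_iterate_mem_le hf hA hne
      rw [hset, Finset.card_insert_of_notMem has, pow_succ']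
      set q := μ.real {x | ∀ j ∈ s, f^[j] x ∈ A}
      set p := μ.real A
      set Q := μ.real (f^[a] ⁻¹' A ∩ {x | ∀ j ∈ s, f^[j] x ∈ A})
      calc |Q - p * p ^ s.card| = |(Q - p * q) + p * (q - p ^ s.card)| := by ring_nf
        _ ≤ |Q - p * q| + p * |q - p ^ s.card| := by
            refine (abs_add_le _ _).trans ?_
            rw [abs_mul, abs_of_nonneg hp0]
        _ ≤ η * p + 1 * (s.card * (η * p)) := by
            gcongr
            exact h1.trans (by gcongr)
        _ = _ := by push_cast; ring

lemma abs_measureReal_inter_forall_iterate_mem_sub_le (hf : MeasurePreserving f μ μ) {A I : Set Ω}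
    (hA : MeasurableSet A) (hI : MeasurableSet I) (hη : 0 ≤ η) (hmix : DecorrelatesAfter f μ g η A)
    (hmixI : DecorrelatesAfter f μ g η I) {s : Finset ℕ} (hne : s.Nonempty)
    (hsep : SeparatedBy g s) (hs : ∀ j ∈ s, g ≤ j) :
    |μ.real (I ∩ {x | ∀ j ∈ s, f^[j] x ∈ A}) - μ.real I * μ.real A ^ s.card|
      ≤ (s.card + 1) * (η * μ.real A) := by
  have h1 := hmixI.peel hf hA hI 0 s (by simpa using hs)
  have h2 := abs_measureReal_forall_iterate_mem_sub_pow_le hf hA hη hmix s hne hsep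
  have h3 := measureReal_forall_iterate_mem_le hf hA hne
  have hp0 : 0 ≤ μ.real I := measureReal_nonneg
  have hp1 : μ.real I ≤ 1 := measureReal_le_one
  simp only [Function.iterate_zero, Set.preimage_id] at h1
  set q := μ.real {x | ∀ j ∈ s, f^[j] x ∈ A}
  set p := μ.real A
  set Q := μ.real (I ∩ {x | ∀ j ∈ s, f^[j] x ∈ A})
  calc |Q - μ.real I * p ^ s.card| = |(Q - μ.real I * q) + μ.real I * (q - p ^ s.card)| := by ring_nf
    _ ≤ |Q - μ.real I * q| + μ.real I * |q - p ^ s.card| := by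
        refine (abs_add_le _ _).trans ?_
        rw [abs_mul, abs_of_nonneg hp0]
    _ ≤ η * p + 1 * (s.card * (η * p)) := by
        gcongr
        exact h1.trans (by gcongr)
    _ = _ := by ring

end Mixing

/-! ### From a fixed target to a moving one: summation over initial cells -/

section Cells

lemma setOf_abs_sub_le_eq {Ω : Type*} (κ : Ω → ℤ) (a : ℤ) (w : ℕ) :
    {y | |κ y - a| ≤ w} = {y | κ y ∈ Set.Icc (a - w) (a + w)} := by
  ext y; simp only [Set.mem_ofPred_eq, Set.mem_Icc, abs_le]; constructor <;> intro h <;> omega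

variable {Ω : Type*} [MeasurableSpace Ω] {f : Ω → Ω} {μ : Measure Ω} {g : ℕ} {η : ℝ}
  {κ : Ω → ℤ}

lemma measurableSet_cells (hκ : Measurable κ) (a : ℤ) (w : ℕ) :
    MeasurableSet {y | |κ y - a| ≤ w} := by
  rw [setOf_abs_sub_le_eq]; exact hκ (by measurability)

lemma tsum_measure_cell_inter (hκ : Measurable κ) {D : Set Ω} (hD : MeasurableSet D) :
    ∑' a : ℤ, μ ({x | κ x = a} ∩ D) = μ D := by
  rw [← measure_iUnion]
  · congr 1; ext x; simp
  · intro a b hab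
    exact Set.disjoint_left.2 fun x hx hy => hab (hx.1.symm.trans hy.1)
  · exact fun a => (hκ (measurableSet_singleton a)).inter hD

/-- Each point belongs to exactly `2 * w + 1` windows, one for each offset between its cell and the
centre. -/
lemma tsum_measure_cells_inter (hκ : Measurable κ) {D : Set Ω} (hD : MeasurableSet D) (w : ℕ) :
    ∑' a : ℤ, μ ({x | |κ x - a| ≤ w} ∩ D) = (2 * w + 1) * μ D := by
  have h1 : ∀ a : ℤ, μ ({x | |κ x - a| ≤ w} ∩ D)
      = ∑ b ∈ Finset.Icc (-(w : ℤ)) w, μ ({x | κ x = a + b} ∩ D) := by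
    intro a
    rw [← measure_biUnion_finset]
    · congr 1; ext x
      simp only [Set.mem_inter_iff, Set.mem_ofPred_eq, Set.mem_iUnion, Finset.mem_Icc, exists_prop,
        abs_le]
      constructor
      · rintro ⟨h, hx⟩; exact ⟨κ x - a, h, by omega, hx⟩
      · rintro ⟨b, hb, h, hx⟩; exact ⟨by omega, hx⟩
    · intro b _ c _ hbc
      refine Set.disjoint_left.2 fun x hx hy => hbc ?_
      have h1 : κ x = a + b := hx.1
      have h2 : κ x = a + c := hy.1
      omega
    · exact fun b _ => (hκ (measurableSet_singleton _)).inter hD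
  simp_rw [h1]
  rw [Summable.tsum_finsetSum fun _ _ => ENNReal.summable]
  have h2 : ∀ b : ℤ, ∑' a : ℤ, μ ({x | κ x = a + b} ∩ D) = μ D := fun b => by
    rw [← tsum_measure_cell_inter (μ := μ) hκ hD]
    exact (Equiv.addRight b).tsum_eq fun a => μ ({x | κ x = a} ∩ D)
  simp_rw [h2]
  rw [Finset.sum_const, Int.card_Icc, nsmul_eq_mul,
    show ((w : ℤ) + 1 - -(w : ℤ)).toNat = 2 * w + 1 by omega]
  push_cast; rfl

lemma tsum_measure_cell_mul (hκ : Measurable κ) (c : ℤ → ℝ≥0∞) :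
    ∑' a : ℤ, μ {x | κ x = a} * c a = ∫⁻ x, c (κ x) ∂μ := by
  have hc : Measurable c := measurable_from_top
  rw [← lintegral_map hc hκ, lintegral_countable']
  refine tsum_congr fun a => ?_
  rw [Measure.map_apply hκ (measurableSet_singleton a), mul_comm]; rfl

variable [IsProbabilityMeasure μ]

/-- Recurrence at separated times, seen through the cells of `κ`, is asymptotically independent
given the initial cell. -/
lemma abs_measureReal_cell_returns_sub_integral_le (hf : MeasurePreserving f μ μ)
    (hκ : Measurable κ) (hη : 0 ≤ η)
    (hmix : ∀ a b : ℤ, DecorrelatesAfter f μ g η {x | κ x ∈ Set.Icc a b}) {s : Finset ℕ}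
    (hne : s.Nonempty) (hsep : SeparatedBy g s) (hs : ∀ j ∈ s, g ≤ j) (w : ℕ) :
    |μ.real {x | ∀ j ∈ s, |κ (f^[j] x) - κ x| ≤ w}
      - ∫ x, μ.real {y | |κ y - κ x| ≤ w} ^ s.card ∂μ| ≤ (s.card + 1) * η * (2 * w + 1) := by
  set m := s.card
  have hA : ∀ a : ℤ, MeasurableSet {y | |κ y - a| ≤ w} := fun a => measurableSet_cells hκ a w
  have hI : ∀ a : ℤ, MeasurableSet {y | κ y = a} := fun a => hκ (measurableSet_singleton a)
  set G : ℤ → Set Ω := fun a => {x | ∀ j ∈ s, f^[j] x ∈ {y | |κ y - a| ≤ w}} with hG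
  have hGm : ∀ a, MeasurableSet (G a) := fun a =>
    measurableSet_forall_iterate_mem hf.measurable (hA a) s id
  set E : Set Ω := {x | ∀ j ∈ s, |κ (f^[j] x) - κ x| ≤ w} with hE
  -- Once the initial cell is fixed, the target no longer depends on `x`, and the mixing estimate
  -- for fixed sets applies.
  have hEG : ∀ a : ℤ, {x | κ x = a} ∩ E = {x | κ x = a} ∩ G a := by
    intro a; ext x
    simp only [hE, hG, Set.mem_inter_iff, Set.mem_ofPred_eq, and_congr_right_iff]
    rintro rfl; rfl
  have hEm : MeasurableSet E := by
    have : E = ⋃ a : ℤ, {x | κ x = a} ∩ G a := by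
      simp_rw [← hEG]; ext x; simp
    rw [this]
    exact MeasurableSet.iUnion fun a => (hI a).inter (hGm a)
  have hterm : ∀ a : ℤ, |μ.real ({x | κ x = a} ∩ E)
      - μ.real {x | κ x = a} * μ.real {y | |κ y - a| ≤ w} ^ m|
      ≤ ((m + 1) * η) * μ.real {y | |κ y - a| ≤ w} := by
    intro a
    rw [hEG, mul_assoc]
    refine abs_measureReal_inter_forall_iterate_mem_sub_le hf (hA a) (hI a) hη ?_ ?_ hne hsep hs
    · rw [setOf_abs_sub_le_eq]; exact hmix _ _
    · have := hmix a a
      simpa [Set.Icc_self] using this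
  set c : ℝ := (m + 1) * η with hc
  have hc0 : 0 ≤ c := by positivity
  -- The sums over cells are taken in `ℝ≥0∞`, where no summability has to be checked.
  have hsumA : ∑' a : ℤ, ENNReal.ofReal c * μ {y | |κ y - a| ≤ w}
      = ENNReal.ofReal (c * (2 * w + 1)) := by
    have := tsum_measure_cells_inter (μ := μ) hκ MeasurableSet.univ w
    simp only [Set.inter_univ, measure_univ, mul_one] at this
    rw [ENNReal.tsum_mul_left, this, ENNReal.ofReal_mul hc0]
    congr 1
    rw [show (2 * (w : ℝ) + 1) = ((2 * w + 1 : ℕ) : ℝ) by push_cast; ring, ENNReal.ofReal_natCast]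
    push_cast; rfl
  have hint : ∑' a : ℤ, μ {x | κ x = a} * μ {y | |κ y - a| ≤ w} ^ m
      = ENNReal.ofReal (∫ x, μ.real {y | |κ y - κ x| ≤ w} ^ m ∂μ) := by
    rw [tsum_measure_cell_mul hκ fun a => μ {y | |κ y - a| ≤ w} ^ m]
    have hmeas : Measurable fun x => μ.real {y | |κ y - κ x| ≤ w} ^ m :=
      (measurable_from_top (f := fun a : ℤ => μ.real {y | |κ y - a| ≤ w} ^ m)).comp hκ
    rw [ofReal_integral_eq_lintegral_ofReal]
    · refine lintegral_congr fun x => ?_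
      rw [ENNReal.ofReal_pow measureReal_nonneg, ofReal_measureReal]
    · refine Integrable.of_bound hmeas.aestronglyMeasurable 1 (ae_of_all _ fun x => ?_)
      rw [Real.norm_of_nonneg (by positivity)]
      exact pow_le_one₀ measureReal_nonneg measureReal_le_one
    · exact ae_of_all _ fun x => by positivity
  have hint0 : 0 ≤ ∫ x, μ.real {y | |κ y - κ x| ≤ w} ^ m ∂μ := integral_nonneg fun x => by positivity
  have hconv : ∀ a : ℤ, ENNReal.ofReal (μ.real {x | κ x = a} * μ.real {y | |κ y - a| ≤ w} ^ m)
      = μ {x | κ x = a} * μ {y | |κ y - a| ≤ w} ^ m := fun a => by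
    rw [ENNReal.ofReal_mul measureReal_nonneg, ENNReal.ofReal_pow measureReal_nonneg,
      ofReal_measureReal, ofReal_measureReal]
  have hconv' : ∀ a : ℤ, ENNReal.ofReal (c * μ.real {y | |κ y - a| ≤ w})
      = ENNReal.ofReal c * μ {y | |κ y - a| ≤ w} := fun a => by
    rw [ENNReal.ofReal_mul hc0, ofReal_measureReal]
  have hsumE : μ E = ∑' a : ℤ, μ ({x | κ x = a} ∩ E) := (tsum_measure_cell_inter hκ hEm).symm
  have hcw : 0 ≤ c * (2 * w + 1) := by positivity
  rw [abs_le]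
  constructor
  · have : ENNReal.ofReal (∫ x, μ.real {y | |κ y - κ x| ≤ w} ^ m ∂μ)
        ≤ ENNReal.ofReal (μ.real E + c * (2 * w + 1)) := by
      rw [ENNReal.ofReal_add measureReal_nonneg hcw, ofReal_measureReal, ← hsumA, hsumE, ← hint,
        ← ENNReal.tsum_add]
      refine ENNReal.tsum_le_tsum fun a => ?_
      rw [← hconv, ← hconv', ← ofReal_measureReal (s := {x | κ x = a} ∩ E),
        ← ENNReal.ofReal_add measureReal_nonneg (by positivity)]
      exact ENNReal.ofReal_le_ofReal (by linarith [(abs_le.1 (hterm a)).1])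
    have := (ENNReal.ofReal_le_ofReal_iff (by positivity)).1 this
    linarith
  · have : ENNReal.ofReal (μ.real E)
        ≤ ENNReal.ofReal (∫ x, μ.real {y | |κ y - κ x| ≤ w} ^ m ∂μ + c * (2 * w + 1)) := by
      rw [ENNReal.ofReal_add hint0 hcw, ofReal_measureReal, ← hsumA, hsumE, ← hint,
        ← ENNReal.tsum_add]
      refine ENNReal.tsum_le_tsum fun a => ?_
      rw [← hconv, ← hconv', ← ofReal_measureReal (s := {x | κ x = a} ∩ E),
        ← ENNReal.ofReal_add (by positivity) (by positivity)]
      exact ENNReal.ofReal_le_ofReal (by linarith [(abs_le.1 (hterm a)).2])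
    have := (ENNReal.ofReal_le_ofReal_iff (by positivity)).1 this
    linarith

/-- From the cell `a`, decorrelation bounds the chance of landing in `D` within the window of `a` by
`P + η` times the mass of that part of `D`; overlapping windows contribute the factor `2 * w + 1`.
With `D` a short-return set this treats pairs of close return times. -/
lemma measureReal_cell_return_inter_le (hf : MeasurePreserving f μ μ)
    (hκ : Measurable κ) (hη : 0 ≤ η)
    (hmix : ∀ a : ℤ, DecorrelatesAfter f μ g η {x | κ x = a}) {P : ℝ} (hP0 : 0 ≤ P)
    (hP : ∀ a : ℤ, μ.real {x | κ x = a} ≤ P) {j : ℕ} (hj : g ≤ j) (w : ℕ) {D : Set Ω}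
    (hD : MeasurableSet D) :
    μ.real ({x | |κ (f^[j] x) - κ x| ≤ w} ∩ f^[j] ⁻¹' D) ≤ (P + η) * (2 * w + 1) * μ.real D := by
  set E : Set Ω := {x | |κ (f^[j] x) - κ x| ≤ w} ∩ f^[j] ⁻¹' D with hE
  have hA : ∀ a : ℤ, MeasurableSet ({y | |κ y - a| ≤ w} ∩ D) := fun a =>
    (measurableSet_cells hκ a w).inter hD
  have hEG : ∀ a : ℤ, {x | κ x = a} ∩ E
      = {x | κ x = a} ∩ f^[j] ⁻¹' ({y | |κ y - a| ≤ w} ∩ D) := by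
    intro a; ext x
    simp only [hE, Set.mem_inter_iff, Set.mem_ofPred_eq, Set.mem_preimage, and_congr_right_iff]
    rintro rfl; rfl
  have hfj := hf.measurable.iterate j
  have hEm : MeasurableSet E := by
    have : E = ⋃ a : ℤ, {x | κ x = a} ∩ f^[j] ⁻¹' ({y | |κ y - a| ≤ w} ∩ D) := by
      simp_rw [← hEG]; ext x; simp
    rw [this]
    exact MeasurableSet.iUnion fun a => (hκ (measurableSet_singleton a)).inter (hfj (hA a))
  have key : ENNReal.ofReal (μ.real E) ≤ ENNReal.ofReal ((P + η) * (2 * w + 1) * μ.real D) := by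
    have hsum := tsum_measure_cells_inter (μ := μ) hκ hD w
    have hw : ENNReal.ofReal (2 * (w : ℝ) + 1) = 2 * w + 1 := by
      rw [show (2 * (w : ℝ) + 1) = ((2 * w + 1 : ℕ) : ℝ) by push_cast; ring,
        ENNReal.ofReal_natCast]
      push_cast; rfl
    rw [mul_assoc, ENNReal.ofReal_mul (by positivity), ENNReal.ofReal_mul (by positivity),
      ofReal_measureReal, ofReal_measureReal, hw, ← hsum, ← ENNReal.tsum_mul_left,
      ← tsum_measure_cell_inter (μ := μ) hκ hEm]
    refine ENNReal.tsum_le_tsum fun a => ?_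
    rw [← ofReal_measureReal, ← ofReal_measureReal (s := _ ∩ D),
      ← ENNReal.ofReal_mul (by positivity), hEG]
    refine ENNReal.ofReal_le_ofReal ?_
    have h1 := (abs_le.1 (hmix a _ (hA a) j hj)).2
    have h2 := mul_le_mul_of_nonneg_right (hP a)
      (measureReal_nonneg (μ := μ) (s := {y | |κ y - a| ≤ w} ∩ D))
    linarith
  exact (ENNReal.ofReal_le_ofReal_iff (by positivity)).1 key

end Cells

/-! ### BV norms of indicators of intervals -/

section BoundedVariation

lemma eVariationOn_le_one_of_monotone {α : Type*} [LinearOrder α] {u : α → ℝ} (hu : Monotone u)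
    (h0 : ∀ x, 0 ≤ u x) (h1 : ∀ x, u x ≤ 1) : eVariationOn u Set.univ ≤ 1 := by
  rw [eVariationOn.eq_biSup_inter_Icc]
  refine iSup₂_le fun p hp => ?_
  rw [(hu.monotoneOn _).eVariationOn_eq hp.1 hp.2.1, ← ENNReal.ofReal_one]
  exact ENNReal.ofReal_le_ofReal (by linarith [h0 p.1, h1 p.2])

lemma eVariationOn_sub_le {α : Type*} [LinearOrder α] (u v : α → ℝ) (s : Set α) :
    eVariationOn (fun x => u x - v x) s ≤ eVariationOn u s + eVariationOn v s := by
  refine iSup_le fun p => ?_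
  refine (Finset.sum_le_sum fun i _ => ?_).trans
    ((Finset.sum_add_distrib (f := fun i => edist (u (p.2.1 (i + 1))) (u (p.2.1 i)))
      (g := fun i => edist (v (p.2.1 (i + 1))) (v (p.2.1 i)))).le.trans
      (add_le_add (eVariationOn.sum_le p.2.2.1 p.2.2.2) (eVariationOn.sum_le p.2.2.1 p.2.2.2)))
  simp only [edist_dist]
  rw [← ENNReal.ofReal_add dist_nonneg dist_nonneg]
  refine ENNReal.ofReal_le_ofReal ?_
  simp only [Real.dist_eq]
  refine le_trans (le_of_eq ?_) (abs_sub _ _)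
  congr 1; ring

/-- Indicators of order-convex sets cut out by a monotone integer-valued function. -/
lemma bvNorm_indicator_le_three {X : Set ℝ} {κ : X → ℤ} (hκ : Monotone κ) (a b : ℤ) :
    bvNorm ({x | κ x ∈ Set.Icc a b}.indicator fun _ => (1 : ℝ)) ≤ 3 := by
  have hmono : ∀ c : ℤ, eVariationOn (fun x => if c ≤ κ x then (1 : ℝ) else 0) Set.univ ≤ 1 := by
    intro c
    refine eVariationOn_le_one_of_monotone (fun x y hxy => ?_) (fun x => ?_) fun x => ?_
    · have := hκ hxy
      show (if c ≤ κ x then (1 : ℝ) else 0) ≤ if c ≤ κ y then (1 : ℝ) else 0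
      split_ifs <;> first | omega | norm_num
    · split_ifs <;> norm_num
    · split_ifs <;> norm_num
  have hvar : eVariationOn ({x | κ x ∈ Set.Icc a b}.indicator fun _ => (1 : ℝ)) Set.univ ≤ 2 := by
    rcases le_or_gt a b with hab | hab
    -- The indicator is a difference of two monotone steps, each of variation at most 1; the
    -- supremum adds the third unit.
    · have heq : ({x | κ x ∈ Set.Icc a b}.indicator fun _ => (1 : ℝ))
          = fun x => (if a ≤ κ x then (1 : ℝ) else 0) - (if b + 1 ≤ κ x then (1 : ℝ) else 0) := by
        funext x
        simp only [Set.indicator_apply, Set.mem_ofPred_eq, Set.mem_Icc]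
        split_ifs <;> first | omega | norm_num
      rw [heq]
      refine (eVariationOn_sub_le _ _ _).trans ((add_le_add (hmono _) (hmono _)).trans ?_)
      norm_num
    · rw [show {x | κ x ∈ Set.Icc a b} = ∅ by ext x; simp [Set.Icc_eq_empty (not_le.2 hab)],
        Set.indicator_empty, eVariationOn.constant_on]
      · simp
      · rintro _ ⟨x, _, rfl⟩ _ ⟨y, _, rfl⟩; rfl
  refine (add_le_add hvar (iSup_le fun x => ?_ : _ ≤ (1 : ℝ≥0∞))).trans (by norm_num)
  simp only [Set.indicator_apply]
  split_ifs <;> simp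

end BoundedVariation

/-! ### Cells of the line compared with balls -/

/-- The index of the cell `[iδ, (i+1)δ)` that contains `x`. -/
noncomputable def cellIndex (X : Set ℝ) (δ : ℝ) (x : X) : ℤ := ⌊(x : ℝ) / δ⌋

section CellIndex

variable {X : Set ℝ} {δ : ℝ}

lemma measurable_cellIndex : Measurable (cellIndex X δ) :=
  (measurable_subtype_coe.div_const δ).floor

lemma monotone_cellIndex (hδ : 0 < δ) : Monotone (cellIndex X δ) := fun _ _ hxy =>
  Int.floor_le_floor (div_le_div_of_nonneg_right hxy hδ.le)

lemma cellIndex_eq_iff (hδ : 0 < δ) (x : X) (a : ℤ) :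
    cellIndex X δ x = a ↔ (x : ℝ) ∈ Set.Ico (a * δ) ((a + 1) * δ) := by
  rw [cellIndex, Int.floor_eq_iff, le_div_iff₀ hδ, div_lt_iff₀ hδ]; rfl

/-- Passing from cells to distances loses one cell, while the converse below loses nothing. A ball
of radius `n * δ` is therefore caught between the windows `n - 1` and `n`. -/
lemma dist_le_of_abs_cellIndex_sub_le (hδ : 0 < δ) {x y : X} {w : ℕ}
    (h : |cellIndex X δ x - cellIndex X δ y| ≤ w) : dist x y ≤ (w + 1) * δ := by
  have hx := (cellIndex_eq_iff hδ x _).1 rfl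
  have hy := (cellIndex_eq_iff hδ y _).1 rfl
  rw [abs_le] at h
  have h1 : (cellIndex X δ x : ℝ) - cellIndex X δ y ≤ w := by exact_mod_cast h.2
  have h2 : -(w : ℝ) ≤ (cellIndex X δ x : ℝ) - cellIndex X δ y := by exact_mod_cast h.1
  rw [Subtype.dist_eq, Real.dist_eq, abs_le]
  constructor <;> nlinarith [hx.1, hx.2, hy.1, hy.2]

lemma abs_cellIndex_sub_le_of_dist_le (hδ : 0 < δ) {x y : X} {w : ℕ}
    (h : dist x y ≤ w * δ) : |cellIndex X δ x - cellIndex X δ y| ≤ w := by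
  have hx := (cellIndex_eq_iff hδ x _).1 rfl
  have hy := (cellIndex_eq_iff hδ y _).1 rfl
  rw [Subtype.dist_eq, Real.dist_eq, abs_le] at h
  have h1 : (cellIndex X δ x : ℝ) < cellIndex X δ y + w + 1 := by
    refine lt_of_mul_lt_mul_right ?_ hδ.le
    nlinarith [hx.1, hx.2, hy.1, hy.2]
  have h2 : (cellIndex X δ y : ℝ) < cellIndex X δ x + w + 1 := by
    refine lt_of_mul_lt_mul_right ?_ hδ.le
    nlinarith [hx.1, hx.2, hy.1, hy.2]
  have h1' : cellIndex X δ x < cellIndex X δ y + w + 1 := by exact_mod_cast h1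
  have h2' : cellIndex X δ y < cellIndex X δ x + w + 1 := by exact_mod_cast h2
  rw [abs_le]; constructor <;> omega

end CellIndex

/-! ### Mass of cells and Lebesgue differentiation -/

section Density

variable {X : Set ℝ} {μ : Measure X} {ρ : X → ℝ}

lemma IsBV.exists_bound (h : IsBV ρ) : ∃ K : ℝ, 0 ≤ K ∧ ∀ x, ρ x ≤ K := by
  have hs : (⨆ x, ‖ρ x‖ₑ) < ∞ := lt_of_le_of_lt le_add_self h
  refine ⟨(⨆ x, ‖ρ x‖ₑ).toReal, ENNReal.toReal_nonneg, fun x => ?_⟩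
  have := ENNReal.toReal_mono hs.ne (le_iSup (fun x => ‖ρ x‖ₑ) x)
  rw [toReal_enorm] at this
  exact (le_abs_self _).trans this

/-- Transfers `μ` to the whole line, with the density extended by 0, where differentiation of
measures is available. -/
lemma IsLebesgueDensity.map_val_eq (hX : MeasurableSet X) (h : IsLebesgueDensity μ ρ) :
    μ.map Subtype.val
      = volume.withDensity fun z => ENNReal.ofReal (Function.extend Subtype.val ρ 0 z) := by
  have hemb := MeasurableEmbedding.subtype_coe hX
  have hext : Measurable (Function.extend (Subtype.val : X → ℝ) ρ 0) :=
    hemb.measurable_extend h.measurable measurable_const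
  ext S hS
  rw [hemb.map_apply, withDensity_apply _ hS, h.eq_withDensity,
    withDensity_apply _ (measurable_subtype_coe hS)]
  have h1 : ∀ x : X, ENNReal.ofReal (ρ x)
      = ENNReal.ofReal (Function.extend Subtype.val ρ 0 (x : ℝ)) := fun x => by
    rw [Subtype.val_injective.extend_apply]
  simp_rw [h1]
  rw [← setLIntegral_map (f := fun z => ENNReal.ofReal (Function.extend Subtype.val ρ 0 z)) hS
    hext.ennreal_ofReal measurable_subtype_coe, lebesgueOn, map_comap_subtype_coe hX,
    Measure.restrict_restrict hS]
  rw [← lintegral_indicator hS, ← lintegral_indicator (hS.inter hX)]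
  refine lintegral_congr fun z => ?_
  by_cases hz : z ∈ X
  · by_cases hzS : z ∈ S <;> simp [hz, hzS]
  · by_cases hzS : z ∈ S <;> simp [hz, hzS]

lemma IsLebesgueDensity.measureReal_preimage_Ico_le [IsProbabilityMeasure μ]
    (hX : MeasurableSet X) (h : IsLebesgueDensity μ ρ) {K : ℝ} (hK0 : 0 ≤ K)
    (hK : ∀ x, ρ x ≤ K) {a b : ℝ} (hab : a ≤ b) :
    μ.real {x | (x : ℝ) ∈ Set.Ico a b} ≤ K * (b - a) := by
  have hle : μ {x | (x : ℝ) ∈ Set.Ico a b} ≤ ENNReal.ofReal (K * (b - a)) := by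
    rw [show {x : X | (x : ℝ) ∈ Set.Ico a b} = Subtype.val ⁻¹' Set.Ico a b from rfl,
      ← Measure.map_apply measurable_subtype_coe measurableSet_Ico, h.map_val_eq hX,
      withDensity_apply _ measurableSet_Ico]
    calc _ ≤ ∫⁻ _ in Set.Ico a b, ENNReal.ofReal K := by
          refine lintegral_mono fun z => ENNReal.ofReal_le_ofReal ?_
          by_cases hz : ∃ x : X, (x : ℝ) = z
          · obtain ⟨x, rfl⟩ := hz
            rw [Subtype.val_injective.extend_apply]; exact hK x
          · rw [Function.extend_apply' _ _ _ hz]; exact hK0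
      _ = _ := by simp [ENNReal.ofReal_mul hK0]
  exact ENNReal.toReal_le_of_le_ofReal (by have := sub_nonneg.2 hab; positivity) hle

/-- Lebesgue differentiation for the density. -/
lemma IsLebesgueDensity.ae_tendsto_measureReal_div [IsProbabilityMeasure μ]
    (hX : MeasurableSet X) (h : IsLebesgueDensity μ ρ) :
    ∀ᵐ x ∂μ, Tendsto (fun r : ℝ => μ.real {y | dist y x ≤ r} / (2 * r)) (𝓝[>] 0) (𝓝 (ρ x)) := by
  have hemb := MeasurableEmbedding.subtype_coe hX
  have hext : Measurable (Function.extend (Subtype.val : X → ℝ) ρ 0) :=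
    hemb.measurable_extend h.measurable measurable_const
  have hprob : IsProbabilityMeasure (μ.map (Subtype.val : X → ℝ)) :=
    Measure.isProbabilityMeasure_map measurable_subtype_coe.aemeasurable
  have hac : μ.map (Subtype.val : X → ℝ) ≪ volume := by
    rw [h.map_val_eq hX]; exact withDensity_absolutelyContinuous _ _
  have hrn : (μ.map (Subtype.val : X → ℝ)).rnDeriv volume
      =ᵐ[volume] fun z => ENNReal.ofReal (Function.extend Subtype.val ρ 0 z) := by
    rw [h.map_val_eq hX]; exact Measure.rnDeriv_withDensity _ hext.ennreal_ofReal
  -- Differentiation holds Lebesgue-almost everywhere; absolute continuity turns this into a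
  -- `μ`-almost sure statement.
  have hall := hac.ae_le ((Besicovitch.ae_tendsto_rnDeriv (μ.map (Subtype.val : X → ℝ)) volume).and
    hrn)
  filter_upwards [ae_of_ae_map measurable_subtype_coe.aemeasurable hall] with x hx
  obtain ⟨h1, h2⟩ := hx
  rw [h2, Subtype.val_injective.extend_apply] at h1
  have h3 := (ENNReal.tendsto_toReal ENNReal.ofReal_ne_top).comp h1
  rw [ENNReal.toReal_ofReal (h.nonneg x)] at h3
  refine h3.congr' ?_
  filter_upwards [self_mem_nhdsWithin] with r hr
  have hr0 : (0 : ℝ) ≤ 2 * r := by have : (0 : ℝ) < r := hr; positivity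
  simp only [Function.comp_apply, ENNReal.toReal_div, Real.volume_closedBall,
    ENNReal.toReal_ofReal hr0]
  rw [Measure.map_apply measurable_subtype_coe Metric.isClosed_closedBall.measurableSet]
  rfl

variable [IsProbabilityMeasure μ]

lemma IsLebesgueDensity.measureReal_cell_le (hX : MeasurableSet X) (h : IsLebesgueDensity μ ρ)
    {K : ℝ} (hK0 : 0 ≤ K) (hK : ∀ x, ρ x ≤ K) {δ : ℝ} (hδ : 0 < δ) (a : ℤ) :
    μ.real {x | cellIndex X δ x = a} ≤ K * δ := by
  simp_rw [cellIndex_eq_iff hδ]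
  refine (h.measureReal_preimage_Ico_le hX hK0 hK (by nlinarith)).trans (le_of_eq (by ring))

lemma IsLebesgueDensity.measureReal_cells_le (hX : MeasurableSet X) (h : IsLebesgueDensity μ ρ)
    {K : ℝ} (hK0 : 0 ≤ K) (hK : ∀ x, ρ x ≤ K) {δ : ℝ} (hδ : 0 < δ) (a : ℤ) (w : ℕ) :
    μ.real {x | |cellIndex X δ x - a| ≤ w} ≤ K * ((2 * w + 1) * δ) := by
  refine (measureReal_mono (s₂ := {x : X | (x : ℝ) ∈ Set.Ico ((a - w) * δ) ((a + w + 1) * δ)})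
    fun x hx => ?_).trans
    ((h.measureReal_preimage_Ico_le hX hK0 hK ?_).trans (le_of_eq (by ring)))
  · have hx1 := (cellIndex_eq_iff hδ x _).1 rfl
    have hx' : |cellIndex X δ x - a| ≤ w := hx
    rw [abs_le] at hx'
    have h1 : (cellIndex X δ x : ℝ) - a ≤ w := by exact_mod_cast hx'.2
    have h2 : -(w : ℝ) ≤ (cellIndex X δ x : ℝ) - a := by exact_mod_cast hx'.1
    constructor <;> nlinarith [hx1.1, hx1.2]
  · have : (0 : ℝ) ≤ w := by positivity
    nlinarith

/-- The ball and the window both lie between the windows `n - 1` and `n`, which differ by two cells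
of mass at most `K * δ` each. -/
lemma IsLebesgueDensity.abs_measureReal_cells_sub_ball_le (hX : MeasurableSet X)
    (h : IsLebesgueDensity μ ρ)
    {K : ℝ} (hK0 : 0 ≤ K) (hK : ∀ x, ρ x ≤ K) {δ : ℝ} (hδ : 0 < δ) (x : X) {n w : ℕ}
    (hw : w ≤ n) (hw' : n ≤ w + 1) :
    |μ.real {y | |cellIndex X δ y - cellIndex X δ x| ≤ w} - μ.real {y | dist y x ≤ n * δ}|
      ≤ 2 * (K * δ) := by
  have hcell := h.measureReal_cell_le hX hK0 hK hδ
  set a := cellIndex X δ x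
  have hball : μ.real {y | dist y x ≤ n * δ} ≤ μ.real {y | |cellIndex X δ y - a| ≤ n} :=
    measureReal_mono fun y hy => abs_cellIndex_sub_le_of_dist_le hδ hy
  -- The smaller radius is the integer `(n : ℤ) - 1`, so that for `n = 0` the smaller window is
  -- empty.
  have hgrow : μ.real {y | |cellIndex X δ y - a| ≤ n}
      ≤ μ.real {y | |cellIndex X δ y - a| ≤ (n : ℤ) - 1} + 2 * (K * δ) := by
    calc _ ≤ μ.real ({y | |cellIndex X δ y - a| ≤ (n : ℤ) - 1} ∪
          ({y | cellIndex X δ y = a + n} ∪ {y | cellIndex X δ y = a - n})) := by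
          refine measureReal_mono fun y hy => ?_
          simp only [Set.mem_ofPred_eq, Set.mem_union, abs_le] at hy ⊢
          omega
      _ ≤ _ := by
          refine (measureReal_union_le _ _).trans ?_
          gcongr
          refine (measureReal_union_le _ _).trans ?_
          linarith [hcell (a + n), hcell (a - n)]
  have h1 : μ.real {y | |cellIndex X δ y - a| ≤ (n : ℤ) - 1} ≤ μ.real {y | dist y x ≤ n * δ} := by
    refine measureReal_mono fun y hy => ?_
    have hy' : |cellIndex X δ y - a| ≤ (n : ℤ) - 1 := hy
    have hn : 1 ≤ n := by have := abs_nonneg (cellIndex X δ y - a); omega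
    have := dist_le_of_abs_cellIndex_sub_le (w := n - 1) hδ (by push_cast [hn]; exact hy')
    push_cast [hn] at this
    simpa using this
  have h2 : μ.real {y | |cellIndex X δ y - a| ≤ (n : ℤ) - 1}
      ≤ μ.real {y | |cellIndex X δ y - a| ≤ w} := measureReal_mono fun y hy => by
    simp only [Set.mem_ofPred_eq] at hy ⊢; omega
  have h3 : μ.real {y | |cellIndex X δ y - a| ≤ w} ≤ μ.real {y | |cellIndex X δ y - a| ≤ n} :=
    measureReal_mono fun y hy => by simp only [Set.mem_ofPred_eq] at hy ⊢; omega
  rw [abs_le]; constructor <;> linarith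

end Density

/-! ### Decay of correlations for windows of cells -/

section Decay

variable {X : Set ℝ} {f : X → X} {μ : Measure X}

/-- The BV norm of the indicator is at most 3 whatever the interval and the cell size, so the
constants survive when the cells shrink with `n`. -/
lemma HasExponentialDecay.exists_decorrelatesAfter (hf : Measurable f)
    (h : HasExponentialDecay f μ) [IsProbabilityMeasure μ] :
    ∃ C > 0, ∃ θ > 0, ∀ (δ : ℝ) (_ : 0 < δ) (g : ℕ) (a b : ℤ),
      DecorrelatesAfter f μ g (C * Real.exp (-θ * g)) {x | cellIndex X δ x ∈ Set.Icc a b} := by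
  obtain ⟨C, hC, θ, hθ, -, hdec⟩ := h
  refine ⟨3 * C, by positivity, θ, hθ, fun δ hδ g a b W hW j hj => ?_⟩
  set A : Set X := {x | cellIndex X δ x ∈ Set.Icc a b} with hA
  have hAm : MeasurableSet A := measurable_cellIndex measurableSet_Icc
  have hbv : bvNorm (A.indicator fun _ => (1 : ℝ)) ≤ 3 :=
    bvNorm_indicator_le_three (monotone_cellIndex hδ) a b
  have key := hdec (A.indicator fun _ => 1) (W.indicator fun _ => 1)
    (hbv.trans_lt (by norm_num)) ((integrable_const 1).indicator hW) j
  have h1 : ∫ x, (A.indicator (fun _ => (1 : ℝ)) x) * (W.indicator (fun _ => (1 : ℝ)) (f^[j] x)) ∂μ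
      = μ.real (A ∩ f^[j] ⁻¹' W) := by
    rw [← integral_indicator_one (hAm.inter (hf.iterate j hW))]
    refine integral_congr_ae (ae_of_all _ fun x => ?_)
    by_cases hx : x ∈ A <;> by_cases hy : f^[j] x ∈ W <;> simp [hx, hy]
  have h2 : ∀ B : Set X, MeasurableSet B → ∫ x, B.indicator (fun _ => (1 : ℝ)) x ∂μ = μ.real B :=
    fun B hB => integral_indicator_one hB
  have h3 : ∫ x, |W.indicator (fun _ => (1 : ℝ)) x| ∂μ = μ.real W := by
    rw [← h2 W hW]
    refine integral_congr_ae (ae_of_all _ fun x => abs_of_nonneg ?_)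
    exact Set.indicator_nonneg (fun _ _ => zero_le_one) x
  rw [correlation, h1, h2 A hAm, h2 W hW, h3] at key
  have h4 : (bvNorm (A.indicator fun _ => (1 : ℝ))).toReal ≤ 3 :=
    ENNReal.toReal_mono (by norm_num) hbv
  have h5 : Real.exp (-θ * j) ≤ Real.exp (-θ * g) := by
    have : (g : ℝ) ≤ j := by exact_mod_cast hj
    exact Real.exp_le_exp.2 (by nlinarith)
  calc _ ≤ _ := key
    _ ≤ C * Real.exp (-θ * g) * 3 * μ.real W := by
        dsimp only; gcongr
    _ = _ := by ring

end Decay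

/-! ### Counting separated and clustered sets of times -/

section Counting

open Classical in
/-- The sets of `m` times in `T` that are not `g`-separated. -/
noncomputable def clusteredSets (g m : ℕ) (T : Finset ℕ) : Finset (Finset ℕ) :=
  (T.powersetCard m).filter fun s => ¬ SeparatedBy g s

open Classical in
/-- The sets of `m` times in `T` that are `g`-separated. -/
noncomputable def separatedSets (g m : ℕ) (T : Finset ℕ) : Finset (Finset ℕ) :=
  (T.powersetCard m).filter fun s => SeparatedBy g s

lemma mem_clusteredSets {g m : ℕ} {T s : Finset ℕ} :
    s ∈ clusteredSets g m T ↔ (s ⊆ T ∧ s.card = m) ∧ ¬ SeparatedBy g s := by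
  simp [clusteredSets, Finset.mem_powersetCard]

lemma mem_separatedSets {g m : ℕ} {T s : Finset ℕ} :
    s ∈ separatedSets g m T ↔ (s ⊆ T ∧ s.card = m) ∧ SeparatedBy g s := by
  simp [separatedSets, Finset.mem_powersetCard]

lemma sum_separatedSets_add_sum_clusteredSets (g m : ℕ) (T : Finset ℕ) (F : Finset ℕ → ℝ) :
    ∑ s ∈ separatedSets g m T, F s + ∑ s ∈ clusteredSets g m T, F s
      = ∑ s ∈ T.powersetCard m, F s := by
  classical
  unfold separatedSets clusteredSets
  convert Finset.sum_filter_add_sum_filter_not (T.powersetCard m) (fun s => SeparatedBy g s) F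

lemma exists_close_pair {g : ℕ} {s : Finset ℕ} (h : ¬ SeparatedBy g s) :
    ∃ i ∈ s, ∃ l, 1 ≤ l ∧ l < g ∧ i + l ∈ s := by
  simp only [SeparatedBy, not_forall] at h
  obtain ⟨i, hi, j, hj, hij, hg⟩ := h
  exact ⟨i, hi, j - i, by omega, by omega, by rwa [Nat.add_sub_cancel' hij.le]⟩

/-- A clustered set is recovered from a time `i`, a lag `l < g` with `i + l` in the set, and the
other `m - 2` times. The factor `n` on the left avoids the exponent `m - 1`. -/
lemma card_clusteredSets_mul_le {g m n : ℕ} {T : Finset ℕ} (hT : T.card ≤ n) :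
    (clusteredSets g m T).card * n ≤ g * n ^ m := by
  classical
  rcases lt_or_ge m 2 with hm | hm
  · have : clusteredSets g m T = ∅ := by
      refine Finset.eq_empty_of_forall_notMem fun s hs => ?_
      obtain ⟨⟨-, hc⟩, hns⟩ := mem_clusteredSets.1 hs
      obtain ⟨i, hi, l, hl, -, hil⟩ := exists_close_pair hns
      have := Finset.card_le_one.1 (by omega : s.card ≤ 1) i hi _ hil
      omega
    simp [this]
  · obtain ⟨k, rfl⟩ := Nat.exists_eq_add_of_le' hm
    have hsub : clusteredSets g (k + 2) T ⊆
        ((T ×ˢ Finset.range g) ×ˢ T.powersetCard k).image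
          fun p => insert p.1.1 (insert (p.1.1 + p.1.2) p.2) := by
      intro s hs
      obtain ⟨⟨hsT, hc⟩, hns⟩ := mem_clusteredSets.1 hs
      obtain ⟨i, hi, l, hl, hlg, hil⟩ := exists_close_pair hns
      have hne : i + l ∈ s.erase i := Finset.mem_erase.2 ⟨by omega, hil⟩
      refine Finset.mem_image.2 ⟨((i, l), (s.erase i).erase (i + l)), ?_, ?_⟩
      · simp only [Finset.mem_product, Finset.mem_range, Finset.mem_powersetCard]
        refine ⟨⟨hsT hi, hlg⟩,
          ((Finset.erase_subset _ _).trans (Finset.erase_subset _ _)).trans hsT, ?_⟩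
        rw [Finset.card_erase_of_mem hne, Finset.card_erase_of_mem hi]; omega
      · dsimp only
        rw [Finset.insert_erase hne, Finset.insert_erase hi]
    have h1 := (Finset.card_le_card hsub).trans Finset.card_image_le
    rw [Finset.card_product, Finset.card_product, Finset.card_range, Finset.card_powersetCard] at h1
    have h2 : T.card.choose k ≤ n ^ k :=
      (Nat.choose_le_pow _ _).trans (Nat.pow_le_pow_left hT k)
    calc _ ≤ T.card * g * T.card.choose k * n := Nat.mul_le_mul_right _ h1
      _ ≤ n * g * n ^ k * n := by gcongr
      _ = _ := by ring

/-- For `N > 2 * q` every factor of the falling factorial is at least `N / 2`; smaller `N` go into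
the constant. This turns bounds on factorial moments into bounds on power moments. -/
lemma pow_le_add_mul_choose (N q : ℕ) :
    (N : ℝ) ^ q ≤ (2 * q : ℝ) ^ q + 2 ^ q * q.factorial * N.choose q := by
  rcases le_or_gt N (2 * q) with h | h
  · have : (N : ℝ) ≤ 2 * q := by exact_mod_cast h
    have := pow_le_pow_left₀ (by positivity) this q
    have h3 : (0 : ℝ) ≤ 2 ^ q * q.factorial * N.choose q := by positivity
    linarith
  · have h1 := Nat.pow_le_choose (α := ℝ) q N
    rw [div_le_iff₀ (by positivity)] at h1
    have h2 : (N : ℝ) ≤ 2 * ((N + 1 - q : ℕ) : ℝ) := by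
      exact_mod_cast (by omega : N ≤ 2 * (N + 1 - q))
    have h3 := pow_le_pow_left₀ (by positivity) h2 q
    rw [mul_pow] at h3
    have h4 : (0 : ℝ) ≤ (2 * q : ℝ) ^ q := by positivity
    have h5 : (2 : ℝ) ^ q * ((N + 1 - q : ℕ) : ℝ) ^ q ≤ 2 ^ q * (N.choose q * q.factorial) := by
      gcongr
    nlinarith

/-- Almost all sets of `m` times are separated: the clustered ones number at most `(g n / n) * n ^
m`. -/
lemma tendsto_card_separatedSets_div {g : ℕ → ℕ} (hg1 : ∀ n, 1 ≤ g n)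
    (hg : Tendsto (fun n => (g n : ℝ) / n) atTop (𝓝 0)) (m : ℕ) :
    Tendsto (fun n : ℕ => ((separatedSets (g n) m (Finset.Icc (g n) n)).card : ℝ) / (n : ℝ) ^ m)
      atTop (𝓝 (1 / m.factorial)) := by
  have hmn : Tendsto (fun n : ℕ => (m : ℝ) / n) atTop (𝓝 0) :=
    tendsto_const_div_atTop_nhds_zero_nat _
  have hlow : Tendsto (fun n : ℕ => (1 - ((g n : ℝ) / n + (m : ℝ) / n)) ^ m / m.factorial
      - (g n : ℝ) / n) atTop (𝓝 (1 / m.factorial)) := by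
    have := ((((hg.add hmn).const_sub 1).pow m).div_const (m.factorial : ℝ)).sub hg
    simpa using this
  have hcard : ∀ n, (Finset.Icc (g n) n).card ≤ n := fun n => by
    have := hg1 n; simp only [Nat.card_Icc]; omega
  refine tendsto_of_tendsto_of_tendsto_of_le_of_le' hlow tendsto_const_nhds ?_ ?_
  · have hev : ∀ᶠ n : ℕ in atTop, (g n : ℝ) / n + (m : ℝ) / n < 1 :=
      (hg.add hmn).eventually (gt_mem_nhds (by norm_num))
    filter_upwards [hev, eventually_gt_atTop 0] with n hn hn0
    have hn0' : (0 : ℝ) < n := by exact_mod_cast hn0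
    have hsplit := sum_separatedSets_add_sum_clusteredSets (g n) m (Finset.Icc (g n) n) fun _ => 1
    simp only [Finset.sum_const, nsmul_eq_mul, mul_one, Finset.card_powersetCard,
      Nat.card_Icc] at hsplit
    have hcl : ((clusteredSets (g n) m (Finset.Icc (g n) n)).card : ℝ) * n ≤ g n * n ^ m := by
      exact_mod_cast card_clusteredSets_mul_le (hcard n)
    have hcl' : ((clusteredSets (g n) m (Finset.Icc (g n) n)).card : ℝ) / n ^ m ≤ g n / n := by
      rw [div_le_div_iff₀ (by positivity) hn0']; exact hcl
    have hch := Nat.pow_le_choose (α := ℝ) m (n + 1 - g n)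
    have hbase : (1 - ((g n : ℝ) / n + (m : ℝ) / n)) * n ≤ ((n + 1 - g n + 1 - m : ℕ) : ℝ) := by
      have e : (1 - ((g n : ℝ) / n + (m : ℝ) / n)) * n = n - g n - m := by field_simp; ring
      rw [e]
      have : (n : ℝ) ≤ ((n + 1 - g n + 1 - m : ℕ) : ℝ) + g n + m := by
        exact_mod_cast (by omega : n ≤ (n + 1 - g n + 1 - m) + g n + m)
      linarith
    have hpow := pow_le_pow_left₀ (mul_nonneg (by linarith) hn0'.le) hbase m
    rw [mul_pow] at hpow
    have hch2 : (1 - ((g n : ℝ) / n + (m : ℝ) / n)) ^ m / m.factorial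
        ≤ ((n + 1 - g n).choose m : ℝ) / n ^ m := by
      rw [le_div_iff₀ (by positivity), div_mul_eq_mul_div]
      exact (div_le_div_of_nonneg_right hpow (by positivity)).trans hch
    rw [← hsplit, add_div] at hch2
    linarith
  · filter_upwards [eventually_gt_atTop 0] with n hn0
    have hn0' : (0 : ℝ) < n := by exact_mod_cast hn0
    have h1 : (separatedSets (g n) m (Finset.Icc (g n) n)).card ≤ n.choose m := by
      classical
      refine (Finset.card_filter_le _ _).trans ?_
      rw [Finset.card_powersetCard]
      exact Nat.choose_le_choose _ (hcard n)
    have h2 : ((separatedSets (g n) m (Finset.Icc (g n) n)).card : ℝ) ≤ n ^ m / m.factorial :=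
      (Nat.cast_le.2 h1).trans (Nat.choose_le_pow_div m n)
    rw [div_le_iff₀ (by positivity)]
    exact h2.trans (le_of_eq (by ring))

end Counting

/-! ### Moments of the number of hits -/

section HitCount

variable {Ω : Type*}

open Classical in
/-- The number of times in `T` at which the event `U j` happens. -/
noncomputable def hitCount (U : ℕ → Set Ω) (T : Finset ℕ) (x : Ω) : ℕ :=
  (T.filter fun j => x ∈ U j).card

/-- The event that `U j` happens at all times in `s`. -/
def allHit (U : ℕ → Set Ω) (s : Finset ℕ) : Set Ω := {x | ∀ j ∈ s, x ∈ U j}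

lemma hitCount_le_card (U : ℕ → Set Ω) (T : Finset ℕ) (x : Ω) : hitCount U T x ≤ T.card := by
  classical exact Finset.card_filter_le _ _

lemma choose_hitCount (U : ℕ → Set Ω) (T : Finset ℕ) (m : ℕ) (x : Ω) :
    ((hitCount U T x).choose m : ℝ)
      = ∑ s ∈ T.powersetCard m, (allHit U s).indicator (fun _ => (1 : ℝ)) x := by
  classical
  simp only [Set.indicator_apply]
  rw [Finset.sum_boole, hitCount, ← Finset.card_powersetCard]
  congr 2
  ext s
  rw [Finset.mem_filter, Finset.mem_powersetCard, Finset.mem_powersetCard]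
  simp only [Finset.subset_iff, Finset.mem_filter]
  constructor
  · rintro ⟨h, hc⟩
    exact ⟨⟨fun j hj => (h hj).1, hc⟩, fun j hj => (h hj).2⟩
  · rintro ⟨⟨h, hc⟩, h'⟩
    exact ⟨fun j hj => ⟨h hj, h' j hj⟩, hc⟩

/-- Distinct times in one residue class modulo `g` are automatically `g`-separated, so estimates for
separated times control each summand completely. -/
lemma hitCount_eq_sum_residues {U : ℕ → Set Ω} {T : Finset ℕ} {g : ℕ} (hg : 1 ≤ g) (x : Ω) :
    hitCount U T x = ∑ c ∈ Finset.range g, hitCount U (T.filter fun j => j % g = c) x := by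
  classical
  unfold hitCount
  rw [Finset.card_eq_sum_card_fiberwise (f := fun j => j % g) (t := Finset.range g)]
  · refine Finset.sum_congr rfl fun c _ => ?_
    rw [Finset.filter_filter, Finset.filter_filter]
    congr 1
    ext j; simp [and_comm]
  · intro j _
    simpa using Nat.mod_lt j hg

lemma separatedBy_of_residue {g c : ℕ} {T s : Finset ℕ}
    (hs : s ⊆ T.filter fun j => j % g = c) : SeparatedBy g s := by
  intro i hi j hj hij
  have h1 := (Finset.mem_filter.1 (hs hi)).2
  have h2 := (Finset.mem_filter.1 (hs hj)).2
  have h3 : g ∣ j - i := (Nat.modEq_iff_dvd' hij.le).1 (h1.trans h2.symm)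
  have := Nat.le_of_dvd (by omega) h3
  omega

variable [MeasurableSpace Ω]

lemma measurableSet_allHit {U : ℕ → Set Ω} (hU : ∀ j, MeasurableSet (U j)) (s : Finset ℕ) :
    MeasurableSet (allHit U s) := by
  have : allHit U s = ⋂ j ∈ s, U j := by ext; simp [allHit]
  rw [this]
  exact Finset.measurableSet_biInter _ fun j _ => hU j

lemma measurable_hitCount {U : ℕ → Set Ω} (hU : ∀ j, MeasurableSet (U j)) (T : Finset ℕ) :
    Measurable (hitCount U T) := by
  classical
  have : hitCount U T = fun x => ∑ j ∈ T, (U j).indicator (fun _ => 1) x := by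
    funext x
    simp only [hitCount, Set.indicator_apply, Finset.card_filter]
  rw [this]
  exact Finset.measurable_sum _ fun j _ => measurable_const.indicator (hU j)

variable {μ : Measure Ω} [IsProbabilityMeasure μ]

lemma integrable_comp_hitCount {U : ℕ → Set Ω} (hU : ∀ j, MeasurableSet (U j)) (T : Finset ℕ)
    (F : ℕ → ℝ) : Integrable (fun x => F (hitCount U T x)) μ := by
  have hm : Measurable fun x => F (hitCount U T x) :=
    (measurable_from_top (f := F)).comp (measurable_hitCount hU T)
  refine Integrable.of_bound hm.aestronglyMeasurable
    (∑ i ∈ Finset.range (T.card + 1), |F i|) (ae_of_all _ fun x => ?_)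
  exact Finset.single_le_sum (f := fun i => |F i|) (fun i _ => abs_nonneg _)
    (Finset.mem_range.2 (Nat.lt_succ_of_le (hitCount_le_card U T x)))

lemma integral_choose_hitCount {U : ℕ → Set Ω} (hU : ∀ j, MeasurableSet (U j)) (T : Finset ℕ)
    (m : ℕ) : ∫ x, ((hitCount U T x).choose m : ℝ) ∂μ
      = ∑ s ∈ T.powersetCard m, μ.real (allHit U s) := by
  simp_rw [choose_hitCount]
  rw [integral_finsetSum _ fun s _ => (integrable_const _).indicator (measurableSet_allHit hU s)]
  exact Finset.sum_congr rfl fun s _ => integral_indicator_one (measurableSet_allHit hU s)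

lemma integral_hitCount_pow_le_of_separated {U : ℕ → Set Ω} (hU : ∀ j, MeasurableSet (U j))
    {T : Finset ℕ} {n q : ℕ} {D : ℝ} (hn : 0 < n) (hT : T.card ≤ n)
    (hD : ∀ s ⊆ T, s.card = q → (n : ℝ) ^ q * μ.real (allHit U s) ≤ D) (hD0 : 0 ≤ D) :
    ∫ x, (hitCount U T x : ℝ) ^ q ∂μ ≤ (2 * q : ℝ) ^ q + 2 ^ q * q.factorial * D := by
  have hn' : (0 : ℝ) < n := by exact_mod_cast hn
  have hch : ∫ x, ((hitCount U T x).choose q : ℝ) ∂μ ≤ D := by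
    rw [integral_choose_hitCount hU]
    calc ∑ s ∈ T.powersetCard q, μ.real (allHit U s)
        ≤ ∑ s ∈ T.powersetCard q, D / n ^ q := by
          refine Finset.sum_le_sum fun s hs => ?_
          obtain ⟨h1, h2⟩ := Finset.mem_powersetCard.1 hs
          rw [le_div_iff₀' (by positivity)]
          exact hD s h1 h2
      _ = (T.card.choose q : ℝ) * (D / n ^ q) := by simp
      _ ≤ (n : ℝ) ^ q * (D / n ^ q) := by
          gcongr
          exact_mod_cast (Nat.choose_le_pow _ _).trans (Nat.pow_le_pow_left hT q)
      _ = D := by field_simp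
  calc ∫ x, (hitCount U T x : ℝ) ^ q ∂μ
      ≤ ∫ x, ((2 * q : ℝ) ^ q + 2 ^ q * q.factorial * (hitCount U T x).choose q) ∂μ := by
        refine integral_mono (integrable_comp_hitCount hU T fun N => (N : ℝ) ^ q)
          (integrable_comp_hitCount hU T fun N => (2 * q : ℝ) ^ q + 2 ^ q * q.factorial * N.choose q)
          fun x => pow_le_add_mul_choose _ _
    _ = (2 * q : ℝ) ^ q + 2 ^ q * q.factorial * ∫ x, ((hitCount U T x).choose q : ℝ) ∂μ := by
        rw [integral_add (integrable_const _)
          (integrable_comp_hitCount hU T fun N => 2 ^ q * q.factorial * (N.choose q : ℝ)),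
          integral_const_mul]
        simp
    _ ≤ _ := by gcongr

/-- Moments of the number of hits grow at most polynomially in the separation `g`, as soon as hits
at `g`-separated times are controlled. -/
lemma integral_hitCount_pow_le {U : ℕ → Set Ω} (hU : ∀ j, MeasurableSet (U j))
    {T : Finset ℕ} {n q g : ℕ} {D : ℝ} (hn : 0 < n) (hT : T.card ≤ n) (hg : 1 ≤ g) (hq : 1 ≤ q)
    (hD : ∀ s ⊆ T, s.card = q → SeparatedBy g s → (n : ℝ) ^ q * μ.real (allHit U s) ≤ D)
    (hD0 : 0 ≤ D) :
    ∫ x, (hitCount U T x : ℝ) ^ q ∂μ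
      ≤ (g : ℝ) ^ q * ((2 * q : ℝ) ^ q + 2 ^ q * q.factorial * D) := by
  obtain ⟨p, rfl⟩ := Nat.exists_eq_add_of_le' hq
  set B : ℝ := (2 * (p + 1 : ℕ) : ℝ) ^ (p + 1) + 2 ^ (p + 1) * (p + 1).factorial * D
  have hcls : ∀ c, ∫ x, (hitCount U (T.filter fun j => j % g = c) x : ℝ) ^ (p + 1) ∂μ ≤ B :=
    fun c => integral_hitCount_pow_le_of_separated hU hn ((Finset.card_filter_le _ _).trans hT)
      (fun s hs hc => hD s (hs.trans (Finset.filter_subset _ _)) hc (separatedBy_of_residue hs)) hD0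
  have hint : ∀ c, Integrable
      (fun x => (hitCount U (T.filter fun j => j % g = c) x : ℝ) ^ (p + 1)) μ :=
    fun c => integrable_comp_hitCount hU _ fun N => (N : ℝ) ^ (p + 1)
  calc ∫ x, (hitCount U T x : ℝ) ^ (p + 1) ∂μ
      ≤ ∫ x, (g : ℝ) ^ p * ∑ c ∈ Finset.range g,
          (hitCount U (T.filter fun j => j % g = c) x : ℝ) ^ (p + 1) ∂μ := by
        refine integral_mono (integrable_comp_hitCount hU T fun N => (N : ℝ) ^ (p + 1))
          ((integrable_finsetSum _ fun c _ => hint c).const_mul _) fun x => ?_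
        dsimp only
        rw [hitCount_eq_sum_residues hg x]
        push_cast
        -- Convexity of the power over the `g` classes costs `g ^ p`; adding up the `g` class bounds
        -- gives one more factor `g`.
        have := pow_sum_le_card_mul_sum_pow (s := Finset.range g)
          (f := fun c => (hitCount U (T.filter fun j => j % g = c) x : ℝ))
          (fun _ _ => by positivity) p
        simpa using this
    _ = (g : ℝ) ^ p * ∑ c ∈ Finset.range g,
          ∫ x, (hitCount U (T.filter fun j => j % g = c) x : ℝ) ^ (p + 1) ∂μ := by
        rw [integral_const_mul, integral_finsetSum _ fun c _ => hint c]
    _ ≤ (g : ℝ) ^ p * ∑ _c ∈ Finset.range g, B := by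
        gcongr with c _
        exact hcls c
    _ = _ := by simp; ring

/-- The clustered part of the factorial moment. -/
lemma sum_clusteredSets_le {U : ℕ → Set Ω} (hU : ∀ j, MeasurableSet (U j))
    {T : Finset ℕ} {n m g : ℕ} {ε h : ℝ} (hε0 : 0 ≤ ε) (hT : T.card ≤ n) (hh : 0 < h)
    (hε : ∀ i ∈ T, ∀ l, 1 ≤ l → l < g → μ.real (U i ∩ U (i + l)) ≤ ε) :
    ∑ s ∈ clusteredSets g m T, μ.real (allHit U s)
      ≤ h * (n * g * ε) + (∫ x, (hitCount U T x : ℝ) ^ (2 * m) ∂μ) / h := by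
  classical
  set B : Set Ω := ⋃ p ∈ T ×ˢ Finset.Ico 1 g, U p.1 ∩ U (p.1 + p.2) with hB
  have hBm : MeasurableSet B :=
    Finset.measurableSet_biUnion _ fun p _ => (hU _).inter (hU _)
  have hBμ : μ.real B ≤ n * g * ε := by
    calc μ.real B ≤ ∑ p ∈ T ×ˢ Finset.Ico 1 g, μ.real (U p.1 ∩ U (p.1 + p.2)) :=
          measureReal_biUnion_finset_le _ _
      _ ≤ ∑ p ∈ T ×ˢ Finset.Ico 1 g, ε := by
          refine Finset.sum_le_sum fun p hp => ?_
          obtain ⟨h1, h2⟩ := Finset.mem_product.1 hp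
          obtain ⟨h2, h3⟩ := Finset.mem_Ico.1 h2
          exact hε _ h1 _ h2 h3
      _ = (T.card : ℝ) * (g - 1 : ℕ) * ε := by simp
      _ ≤ n * g * ε := by
          gcongr
          exact Nat.sub_le _ _
  -- Off `B` no clustered set is fully hit, so the sum vanishes. On `B` it is at most `t = N ^ m`,
  -- and `t ≤ h + t ^ 2 / h`: the level `h` trades the small measure of `B` against a moment of
  -- order `2 * m`.
  have hpt : ∀ x, ∑ s ∈ clusteredSets g m T, (allHit U s).indicator (fun _ => (1 : ℝ)) x
      ≤ h * B.indicator (fun _ => (1 : ℝ)) x + (hitCount U T x : ℝ) ^ (2 * m) / h := by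
    intro x
    have hle : ∑ s ∈ clusteredSets g m T, (allHit U s).indicator (fun _ => (1 : ℝ)) x
        ≤ (hitCount U T x : ℝ) ^ m := by
      calc _ ≤ ∑ s ∈ T.powersetCard m, (allHit U s).indicator (fun _ => (1 : ℝ)) x :=
            Finset.sum_le_sum_of_subset_of_nonneg (Finset.filter_subset _ _) fun s _ _ =>
              Set.indicator_nonneg (fun _ _ => zero_le_one) x
        _ = ((hitCount U T x).choose m : ℝ) := (choose_hitCount U T m x).symm
        _ ≤ _ := by exact_mod_cast Nat.choose_le_pow _ _
    by_cases hx : x ∈ B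
    · rw [Set.indicator_of_mem hx, mul_one]
      refine hle.trans ?_
      set t := (hitCount U T x : ℝ) ^ m
      have ht : (0 : ℝ) ≤ t := by positivity
      rw [show (hitCount U T x : ℝ) ^ (2 * m) = t ^ 2 by rw [mul_comm, pow_mul]]
      have : t * h ≤ (h + t ^ 2 / h) * h := by
        rw [add_mul, div_mul_cancel₀ _ hh.ne']
        nlinarith [sq_nonneg (t - h)]
      exact le_of_mul_le_mul_right this hh
    · have hz : ∑ s ∈ clusteredSets g m T, (allHit U s).indicator (fun _ => (1 : ℝ)) x = 0 := by
        refine Finset.sum_eq_zero fun s hs => Set.indicator_of_notMem (fun hxs => hx ?_) _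
        obtain ⟨⟨hsT, -⟩, hns⟩ := mem_clusteredSets.1 hs
        obtain ⟨i, hi, l, hl, hlg, hil⟩ := exists_close_pair hns
        refine Set.mem_biUnion (x := (i, l)) ?_ ⟨hxs i hi, hxs _ hil⟩
        simp [hsT hi, hl, hlg]
      rw [hz, Set.indicator_of_notMem hx]
      positivity
  have hintH : Integrable (fun x => (hitCount U T x : ℝ) ^ (2 * m) / h) μ :=
    integrable_comp_hitCount hU T fun N => (N : ℝ) ^ (2 * m) / h
  have hintB : Integrable (fun x => h * B.indicator (fun _ => (1 : ℝ)) x) μ :=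
    ((integrable_const _).indicator hBm).const_mul _
  calc ∑ s ∈ clusteredSets g m T, μ.real (allHit U s)
      = ∫ x, ∑ s ∈ clusteredSets g m T, (allHit U s).indicator (fun _ => (1 : ℝ)) x ∂μ := by
        rw [integral_finsetSum _ fun s _ =>
          (integrable_const _).indicator (measurableSet_allHit hU s)]
        exact Finset.sum_congr rfl fun s _ =>
          (integral_indicator_one (measurableSet_allHit hU s)).symm
    _ ≤ ∫ x, (h * B.indicator (fun _ => (1 : ℝ)) x + (hitCount U T x : ℝ) ^ (2 * m) / h) ∂μ :=
        integral_mono (integrable_finsetSum _ fun s _ =>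
          (integrable_const _).indicator (measurableSet_allHit hU s)) (hintB.add hintH) hpt
    _ = h * μ.real B + (∫ x, (hitCount U T x : ℝ) ^ (2 * m) ∂μ) / h := by
        rw [integral_add hintB hintH, integral_const_mul, integral_div]
        congr 2
        exact integral_indicator_one hBm
    _ ≤ _ := by gcongr

end HitCount

/-! ### Convergence of factorial moments -/

section FactorialMoments

variable {Ω : Type*} [MeasurableSpace Ω]

/-- Hits at `m` times that are `g n`-separated have probability asymptotic to `Λ / n ^ m`,
uniformly in the times. -/
def HasSeparatedAsymptotics (μ : Measure Ω) (U : ℕ → ℕ → Set Ω) (g : ℕ → ℕ) (m : ℕ)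
    (Λ : ℝ) : Prop :=
  ∃ a b : ℕ → ℝ, Tendsto a atTop (𝓝 Λ) ∧ Tendsto b atTop (𝓝 Λ) ∧
    ∀ᶠ n : ℕ in atTop, ∀ s : Finset ℕ, s.card = m → SeparatedBy (g n) s → (∀ j ∈ s, g n ≤ j) →
      a n ≤ (n : ℝ) ^ m * μ.real (allHit (U n) s) ∧ (n : ℝ) ^ m * μ.real (allHit (U n) s) ≤ b n

variable {μ : Measure Ω} {U : ℕ → ℕ → Set Ω} {g : ℕ → ℕ}

lemma HasSeparatedAsymptotics.tendsto_sum {m : ℕ} {Λ : ℝ} (h : HasSeparatedAsymptotics μ U g m Λ)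
    (hg1 : ∀ n, 1 ≤ g n) (hg : Tendsto (fun n => (g n : ℝ) / n) atTop (𝓝 0)) :
    Tendsto (fun n => ∑ s ∈ separatedSets (g n) m (Finset.Icc (g n) n), μ.real (allHit (U n) s))
      atTop (𝓝 (Λ / m.factorial)) := by
  obtain ⟨a, b, ha, hb, hab⟩ := h
  have hcard := tendsto_card_separatedSets_div hg1 hg m
  have e : Λ / m.factorial = 1 / m.factorial * Λ := by ring
  rw [e]
  refine tendsto_of_tendsto_of_tendsto_of_le_of_le' (hcard.mul ha) (hcard.mul hb) ?_ ?_
  all_goals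
    filter_upwards [hab, eventually_gt_atTop 0] with n hn hn0
    have hn0' : (0 : ℝ) < n := by exact_mod_cast hn0
    have hbd : ∀ s ∈ separatedSets (g n) m (Finset.Icc (g n) n),
        a n / n ^ m ≤ μ.real (allHit (U n) s) ∧ μ.real (allHit (U n) s) ≤ b n / n ^ m := by
      intro s hs
      obtain ⟨⟨hsT, hc⟩, hsep⟩ := mem_separatedSets.1 hs
      rw [div_le_iff₀' (by positivity), le_div_iff₀' (by positivity)]
      exact hn s hc hsep fun j hj => (Finset.mem_Icc.1 (hsT hj)).1
  · have := Finset.card_nsmul_le_sum _ _ _ fun s hs => (hbd s hs).1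
    rw [nsmul_eq_mul] at this
    exact (le_of_eq (by ring)).trans this
  · have := Finset.sum_le_card_nsmul _ _ _ fun s hs => (hbd s hs).2
    rw [nsmul_eq_mul] at this
    exact this.trans (le_of_eq (by ring))

/-- Convergence of factorial moments from separated asymptotics and a bound for close pairs. -/
theorem tendsto_integral_choose_hitCount [IsProbabilityMeasure μ] (hU : ∀ n j, MeasurableSet (U n j))
    (hg1 : ∀ n, 1 ≤ g n) (hg : Tendsto (fun n => (g n : ℝ) / n) atTop (𝓝 0))
    {Λ : ℕ → ℝ} (hΛ : ∀ m, 1 ≤ m → HasSeparatedAsymptotics μ U g m (Λ m))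
    {ε h : ℕ → ℝ} (hε0 : ∀ n, 0 ≤ ε n) (hh0 : ∀ᶠ n in atTop, 0 < h n)
    (hε : ∀ᶠ n in atTop, ∀ i ∈ Finset.Icc (g n) n, ∀ l, 1 ≤ l → l < g n →
      μ.real (U n i ∩ U n (i + l)) ≤ ε n)
    (hlim : Tendsto (fun n : ℕ => h n * (n * g n * ε n)) atTop (𝓝 0))
    (hpow : ∀ q : ℕ, Tendsto (fun n => (g n : ℝ) ^ q / h n) atTop (𝓝 0)) {m : ℕ} (hm : 1 ≤ m) :
    Tendsto (fun n => ∫ x, ((hitCount (U n) (Finset.Icc (g n) n) x).choose m : ℝ) ∂μ) atTop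
      (𝓝 (Λ m / m.factorial)) := by
  have hsep := (hΛ m hm).tendsto_sum hg1 hg
  -- The clustered part of order `m` is controlled by the moment of order `2 * m`, hence the
  -- asymptotics at this second order.
  obtain ⟨a, b, -, hb, hab⟩ := hΛ (2 * m) (by omega)
  set D : ℝ := |Λ (2 * m)| + 1 with hD
  have hbD : ∀ᶠ n in atTop, b n ≤ D :=
    (hb.eventually (gt_mem_nhds (by rw [hD]; linarith [le_abs_self (Λ (2 * m))]))).mono
      fun n hn => hn.le
  set B : ℝ := (2 * (2 * m : ℕ) : ℝ) ^ (2 * m) + 2 ^ (2 * m) * (2 * m).factorial * D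
  have hupper : Tendsto (fun n : ℕ => h n * (n * g n * ε n) + (g n : ℝ) ^ (2 * m) / h n * B) atTop
      (𝓝 0) := by simpa using hlim.add ((hpow (2 * m)).mul_const B)
  have hcl : Tendsto (fun n => ∑ s ∈ clusteredSets (g n) m (Finset.Icc (g n) n),
      μ.real (allHit (U n) s)) atTop (𝓝 0) := by
    refine tendsto_of_tendsto_of_tendsto_of_le_of_le' tendsto_const_nhds hupper
      (Eventually.of_forall fun n => Finset.sum_nonneg fun s _ => measureReal_nonneg) ?_
    filter_upwards [hab, hbD, hh0, hε, eventually_gt_atTop 0] with n hn hbn hhn hεn hn0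
    have hcard : (Finset.Icc (g n) n).card ≤ n := by
      have := hg1 n; simp only [Nat.card_Icc]; omega
    refine (sum_clusteredSets_le (hU n) (hε0 n) hcard hhn hεn).trans ?_
    have hmom := integral_hitCount_pow_le (μ := μ) (hU n) hn0 hcard (hg1 n)
      (by omega : 1 ≤ 2 * m) (D := D)
      (fun s hs hc hsp => ((hn s hc hsp fun j hj => (Finset.mem_Icc.1 (hs hj)).1).2).trans hbn)
      (by positivity)
    rw [div_mul_eq_mul_div]
    gcongr
  have := hsep.add hcl
  rw [add_zero] at this
  refine this.congr fun n => ?_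
  rw [sum_separatedSets_add_sum_clusteredSets, integral_choose_hitCount (hU n)]

end FactorialMoments

/-! ### From factorial moments to a mixed Poisson law -/

section Bonferroni

lemma choose_mul_choose_add (N k t : ℕ) :
    (k + t).choose k * N.choose (k + t) = N.choose k * (N - k).choose t := by
  have := Nat.choose_mul (n := N) (k := k + t) (s := k) (Nat.le_add_right _ _)
  rw [Nat.add_sub_cancel_left] at this
  rw [mul_comm, this]

/-- Bonferroni inequalities for the event that a count equals `k`. -/
lemma abs_ite_sub_sum_choose_le (N k M : ℕ) :
    |(if N = k then (1 : ℝ) else 0)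
      - ∑ t ∈ Finset.range M, (-1) ^ t * ((k + t).choose k : ℝ) * (N.choose (k + t) : ℝ)|
      ≤ ((k + M).choose k : ℝ) * (N.choose (k + M) : ℝ) := by
  have hcast : ∀ t, ((k + t).choose k : ℝ) * (N.choose (k + t) : ℝ)
      = (N.choose k : ℝ) * ((N - k).choose t : ℝ) := fun t => by
    exact_mod_cast choose_mul_choose_add N k t
  simp_rw [mul_assoc, hcast, mul_left_comm _ (N.choose k : ℝ), ← Finset.mul_sum]
  rcases lt_trichotomy N k with h | rfl | h
  · simp [Nat.choose_eq_zero_of_lt h, h.ne]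
  · cases M with
    | zero => simp
    | succ p => simp [Finset.sum_range_succ']
  · rw [if_neg h.ne']
    cases M with
    | zero => simp
    | succ p =>
      -- The truncated alternating sum of row `d + 1` of Pascal's triangle is `(-1) ^ p * d.choose
      -- p`, at most the first omitted term in absolute value.
      obtain ⟨d, hd⟩ : ∃ d, N - k = d + 1 := ⟨N - k - 1, by omega⟩
      rw [hd]
      have hsum : ∑ t ∈ Finset.range (p + 1), (-1 : ℝ) ^ t * ((d + 1).choose t : ℝ)
          = (-1) ^ p * d.choose p := by
        exact_mod_cast Int.alternating_sum_range_choose_eq_choose (n := d) (m := p)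
      rw [hsum, zero_sub, abs_neg, abs_mul, abs_mul, abs_pow, abs_neg, abs_one, one_pow, one_mul,
        Nat.abs_cast, Nat.abs_cast]
      gcongr
      rw [Nat.choose_succ_succ]
      omega

/-- Exchanges two limits: the error need not vanish as `n → ∞` for fixed `M`, only its limit must
vanish as `M → ∞`. -/
lemma tendsto_of_approximations {p : ℕ → ℝ} {a e : ℕ → ℕ → ℝ} {A E : ℕ → ℝ} {T : ℝ}
    (hpa : ∀ M n, |p n - a M n| ≤ e M n) (ha : ∀ M, Tendsto (a M) atTop (𝓝 (A M)))
    (he : ∀ M, Tendsto (e M) atTop (𝓝 (E M))) (hA : Tendsto A atTop (𝓝 T))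
    (hE : Tendsto E atTop (𝓝 0)) : Tendsto p atTop (𝓝 T) := by
  rw [Metric.tendsto_atTop']
  intro ε hε
  have h1 : ∀ᶠ M in atTop, |A M - T| < ε / 3 := by
    have := (Metric.tendsto_nhds.1 hA) (ε / 3) (by positivity)
    simpa [Real.dist_eq] using this
  have h2 : ∀ᶠ M in atTop, E M < ε / 3 := hE.eventually (gt_mem_nhds (by positivity))
  obtain ⟨M, hM1, hM2⟩ := (h1.and h2).exists
  have h3 : ∀ᶠ n in atTop, |a M n - A M| < ε / 3 := by
    have := (Metric.tendsto_nhds.1 (ha M)) (ε / 3) (by positivity)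
    simpa [Real.dist_eq] using this
  have h4 : ∀ᶠ n in atTop, e M n < ε / 3 := (he M).eventually (gt_mem_nhds hM2)
  obtain ⟨n₀, hn₀⟩ := eventually_atTop.1 (h3.and h4)
  refine ⟨n₀, fun n hn => ?_⟩
  obtain ⟨h5, h6⟩ := hn₀ n hn.le
  have h7 := hpa M n
  rw [Real.dist_eq]
  rw [abs_lt] at *
  rw [abs_le] at h7
  constructor <;> linarith

variable {Ω : Type*} [MeasurableSpace Ω] {μ : Measure Ω} [IsProbabilityMeasure μ]

/-- Convergence to a mixed Poisson law with bounded parameter from convergence of the factorial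
moments. -/
theorem tendsto_measureReal_eq_of_factorialMoments {N : ℕ → Ω → ℕ} (hN : ∀ n, Measurable (N n))
    (hint : ∀ n m, Integrable (fun x => ((N n x).choose m : ℝ)) μ) {u : Ω → ℝ} (hu : Measurable u)
    (hu0 : ∀ x, 0 ≤ u x) {K : ℝ} (huK : ∀ x, u x ≤ K)
    (hlim : ∀ m, 1 ≤ m → Tendsto (fun n => ∫ x, ((N n x).choose m : ℝ) ∂μ) atTop
      (𝓝 ((∫ x, u x ^ m ∂μ) / m.factorial))) {k : ℕ} (hk : 1 ≤ k) :
    Tendsto (fun n => μ.real {x | N n x = k}) atTop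
      (𝓝 (∫ x, u x ^ k / k.factorial * Real.exp (-u x) ∂μ)) := by
  have hupow : ∀ m, Integrable (fun x => u x ^ m) μ := fun m => by
    refine Integrable.of_bound (hu.pow_const m).aestronglyMeasurable (K ^ m)
      (ae_of_all _ fun x => ?_)
    rw [Real.norm_of_nonneg (pow_nonneg (hu0 x) m)]
    exact pow_le_pow_left₀ (hu0 x) (huK x) m
  obtain ⟨x₀⟩ : Nonempty Ω := nonempty_of_isProbabilityMeasure μ
  have hK0 : 0 ≤ K := (hu0 x₀).trans (huK x₀)
  -- This identity turns the limiting Bonferroni sum into `u ^ k / k!` times a Taylor polynomial of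
  -- `exp (-u)`.
  have hfac : ∀ t : ℕ, ((k + t).choose k : ℝ) / (k + t).factorial
      = 1 / (k.factorial * t.factorial) := fun t => by
    have := Nat.add_choose_mul_factorial_mul_factorial k t
    rw [Nat.choose_symm_add, div_eq_div_iff (by positivity) (by positivity), one_mul, ← this]
    push_cast; ring
  refine tendsto_of_approximations
    (a := fun M n => ∑ t ∈ Finset.range M, (-1) ^ t * ((k + t).choose k : ℝ)
      * ∫ x, ((N n x).choose (k + t) : ℝ) ∂μ)
    (e := fun M n => ((k + M).choose k : ℝ) * ∫ x, ((N n x).choose (k + M) : ℝ) ∂μ)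
    (A := fun M => ∑ t ∈ Finset.range M, (-1) ^ t * ((k + t).choose k : ℝ)
      * ((∫ x, u x ^ (k + t) ∂μ) / (k + t).factorial))
    (E := fun M => ((k + M).choose k : ℝ) * ((∫ x, u x ^ (k + M) ∂μ) / (k + M).factorial))
    ?_ ?_ ?_ ?_ ?_
  · intro M n
    have hset : MeasurableSet {x | N n x = k} := hN n (measurableSet_singleton k)
    have h1 : μ.real {x | N n x = k} = ∫ x, (if N n x = k then (1 : ℝ) else 0) ∂μ := by
      rw [← integral_indicator_one hset]
      refine integral_congr_ae (ae_of_all _ fun x => ?_)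
      simp [Set.indicator_apply]
    have hi1 : Integrable (fun x => if N n x = k then (1 : ℝ) else 0) μ := by
      refine ((integrable_const (1 : ℝ)).indicator hset).congr (ae_of_all _ fun x => ?_)
      simp [Set.indicator_apply]
    have hi2 : ∀ t ∈ Finset.range M, Integrable (fun x => (-1) ^ t * ((k + t).choose k : ℝ)
        * ((N n x).choose (k + t) : ℝ)) μ := fun t _ => (hint n (k + t)).const_mul _
    have h2 : ∑ t ∈ Finset.range M, (-1) ^ t * ((k + t).choose k : ℝ)
        * ∫ x, ((N n x).choose (k + t) : ℝ) ∂μ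
        = ∫ x, ∑ t ∈ Finset.range M, (-1) ^ t * ((k + t).choose k : ℝ)
          * ((N n x).choose (k + t) : ℝ) ∂μ := by
      rw [integral_finsetSum _ hi2]
      simp_rw [integral_const_mul]
    rw [h1, h2, ← integral_sub hi1 (integrable_finsetSum _ hi2), ← integral_const_mul]
    refine (abs_integral_le_integral_abs).trans (integral_mono
      (hi1.sub (integrable_finsetSum _ hi2)).abs ((hint n (k + M)).const_mul _) fun x => ?_)
    exact abs_ite_sub_sum_choose_le _ _ _
  · exact fun M => tendsto_finsetSum _ fun t _ => (hlim (k + t) (by omega)).const_mul _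
  · exact fun M => (hlim (k + M) (by omega)).const_mul _
  · have hA : ∀ M, ∑ t ∈ Finset.range M, (-1) ^ t * ((k + t).choose k : ℝ)
        * ((∫ x, u x ^ (k + t) ∂μ) / (k + t).factorial)
        = ∫ x, u x ^ k / k.factorial * ∑ t ∈ Finset.range M, (-u x) ^ t / t.factorial ∂μ := by
      intro M
      simp_rw [Finset.mul_sum]
      have he : ∀ t : ℕ, ∀ x, u x ^ k / k.factorial * ((-u x) ^ t / t.factorial)
          = (-1) ^ t * (((k + t).choose k : ℝ) / (k + t).factorial) * u x ^ (k + t) := by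
        intro t x
        rw [hfac, neg_pow, pow_add]
        field_simp
      simp_rw [he]
      rw [integral_finsetSum _ fun t _ => (hupow (k + t)).const_mul _]
      refine Finset.sum_congr rfl fun t _ => ?_
      rw [integral_const_mul]; ring
    simp_rw [hA]
    refine tendsto_integral_of_dominated_convergence
      (fun _ => K ^ k / k.factorial * Real.exp K) (fun M => ?_) (integrable_const _) (fun M => ?_) ?_
    · refine Measurable.aestronglyMeasurable ?_
      fun_prop
    · refine ae_of_all _ fun x => ?_
      rw [norm_mul, Real.norm_of_nonneg (by have := hu0 x; positivity)]
      have h1 : u x ^ k ≤ K ^ k := pow_le_pow_left₀ (hu0 x) (huK x) k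
      have h2 : ‖∑ t ∈ Finset.range M, (-u x) ^ t / (t.factorial : ℝ)‖ ≤ Real.exp K := by
        refine (norm_sum_le _ _).trans (le_trans (Finset.sum_le_sum fun t _ => ?_)
          (Real.sum_le_exp_of_nonneg hK0 M))
        rw [norm_div, norm_pow, norm_neg, Real.norm_of_nonneg (hu0 x), RCLike.norm_natCast]
        have := pow_le_pow_left₀ (hu0 x) (huK x) t
        gcongr
      gcongr
    · refine ae_of_all _ fun x => Tendsto.const_mul _ ?_
      have := NormedSpace.expSeries_div_hasSum_exp (𝔸 := ℝ) (-u x)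
      rw [← Real.exp_eq_exp_ℝ] at this
      exact this.tendsto_sum_nat
  -- The bound `u ≤ K` makes the limiting truncation error at most a constant times `K ^ M / M!`.
  · have hup : Tendsto (fun M : ℕ => K ^ k / k.factorial * (K ^ M / M.factorial)) atTop (𝓝 0) := by
      simpa using (FloorSemiring.tendsto_pow_div_factorial_atTop K).const_mul (K ^ k / k.factorial)
    refine squeeze_zero (fun M => ?_) (fun M => ?_) hup
    · have : 0 ≤ ∫ x, u x ^ (k + M) ∂μ := integral_nonneg fun x => pow_nonneg (hu0 x) _
      positivity
    · have h1 : ∫ x, u x ^ (k + M) ∂μ ≤ K ^ (k + M) := by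
        calc _ ≤ ∫ _, K ^ (k + M) ∂μ := integral_mono (hupow _) (integrable_const _) fun x =>
              pow_le_pow_left₀ (hu0 x) (huK x) _
          _ = _ := by simp
      calc _ = ((k + M).choose k : ℝ) / (k + M).factorial * ∫ x, u x ^ (k + M) ∂μ := by ring
        _ = 1 / (k.factorial * M.factorial) * ∫ x, u x ^ (k + M) ∂μ := by rw [hfac]
        _ ≤ 1 / (k.factorial * M.factorial) * K ^ (k + M) := by gcongr
        _ = _ := by rw [pow_add]; field_simp

end Bonferroni

/-! ### The gap: polylogarithmic, yet enough to beat every power of `n` -/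

/-- The time separation `⌊(log n)²⌋ + 1`. -/
noncomputable def logGap (n : ℕ) : ℕ := ⌊Real.log n ^ 2⌋₊ + 1

section LogGap

lemma one_le_logGap (n : ℕ) : 1 ≤ logGap n := Nat.le_add_left _ _

lemma sq_log_le_logGap (n : ℕ) : Real.log n ^ 2 ≤ logGap n := by
  rw [logGap]; push_cast; exact (Nat.lt_floor_add_one _).le

/-- Lags strictly below the gap are exactly those covered by the short-return hypothesis. -/
lemma le_sq_log_of_lt_logGap {n l : ℕ} (h : l < logGap n) : (l : ℝ) ≤ Real.log n ^ 2 :=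
  (Nat.le_floor_iff (by positivity)).1 (Nat.lt_succ_iff.1 h)

lemma tendsto_logGap_pow_div_rpow (q : ℕ) {s : ℝ} (hs : 0 < s) :
    Tendsto (fun n : ℕ => (logGap n : ℝ) ^ q / (n : ℝ) ^ s) atTop (𝓝 0) := by
  have hlog : Tendsto (fun n : ℕ => Real.log n) atTop atTop :=
    Real.tendsto_log_atTop.comp tendsto_natCast_atTop_atTop
  have h1 : Tendsto (fun n : ℕ => Real.log n ^ (2 * q : ℝ) / (n : ℝ) ^ s) atTop (𝓝 0) :=
    ((isLittleO_log_rpow_rpow_atTop (2 * q : ℝ) hs).tendsto_div_nhds_zero).comp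
      tendsto_natCast_atTop_atTop
  have h2 : Tendsto (fun n : ℕ => 2 ^ q * (Real.log n ^ (2 * q : ℝ) / (n : ℝ) ^ s)) atTop
      (𝓝 0) := by simpa using h1.const_mul (2 ^ q)
  refine tendsto_of_tendsto_of_tendsto_of_le_of_le' tendsto_const_nhds h2
    (Eventually.of_forall fun n => by positivity) ?_
  filter_upwards [hlog.eventually_ge_atTop 1] with n hn
  have h3 : (logGap n : ℝ) ≤ 2 * Real.log n ^ 2 := by
    have := Nat.floor_le (by positivity : 0 ≤ Real.log n ^ 2)
    rw [logGap]; push_cast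
    nlinarith
  have h4 : Real.log n ^ (2 * q : ℝ) = (Real.log n ^ 2) ^ q := by
    rw [← pow_mul, ← Real.rpow_natCast]; push_cast; rfl
  rw [h4, ← mul_div_assoc, ← mul_pow]
  gcongr

/-- The square is essential: `θ (log n)²` eventually exceeds `q log n` for every `q`, however small
`θ` is. -/
lemma tendsto_pow_mul_exp_neg_logGap {θ : ℝ} (hθ : 0 < θ) (q : ℕ) :
    Tendsto (fun n : ℕ => (n : ℝ) ^ q * Real.exp (-θ * logGap n)) atTop (𝓝 0) := by
  have hlog : Tendsto (fun n : ℕ => Real.log n) atTop atTop :=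
    Real.tendsto_log_atTop.comp tendsto_natCast_atTop_atTop
  have h1 : Tendsto (fun n : ℕ => Real.log n * (θ * Real.log n - q)) atTop atTop :=
    hlog.atTop_mul_atTop₀ (tendsto_atTop_add_const_right _ _ (hlog.const_mul_atTop hθ))
  have h2 : Tendsto (fun n : ℕ => Real.exp (-(Real.log n * (θ * Real.log n - q)))) atTop (𝓝 0) :=
    Real.tendsto_exp_neg_atTop_nhds_zero.comp h1
  refine tendsto_of_tendsto_of_tendsto_of_le_of_le' tendsto_const_nhds h2
    (Eventually.of_forall fun n => by positivity) ?_
  filter_upwards [eventually_gt_atTop 0] with n hn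
  have hn' : (0 : ℝ) < n := by exact_mod_cast hn
  have h3 : (n : ℝ) ^ q = Real.exp (q * Real.log n) := by
    rw [← Real.log_pow, Real.exp_log (by positivity)]
  rw [h3, ← Real.exp_add]
  refine Real.exp_le_exp.2 ?_
  have := mul_le_mul_of_nonneg_left (sq_log_le_logGap n) hθ.le
  nlinarith

end LogGap

/-! ### Probability of returns at separated times -/

section Recurrence

variable {X : Set ℝ} {f : X → X} {μ : Measure X} {ρ : X → ℝ}

/-- The event that `f^j x` returns to within `τ / (2n)` of `x`. -/
def returnEvent (f : X → X) (τ : ℝ) (n j : ℕ) : Set X := {x | dist (f^[j] x) x ≤ τ / (2 * n)}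

lemma measurableSet_returnEvent (hf : Measurable f) (τ : ℝ) (n j : ℕ) :
    MeasurableSet (returnEvent f τ n j) :=
  measurableSet_le ((hf.iterate j).dist measurable_id) measurable_const

/-- The cell size used at level `n`; a ball of radius `τ / (2n)` has radius `n` cells. -/
noncomputable def cellSize (τ : ℝ) (n : ℕ) : ℝ := τ / (2 * (n : ℝ) ^ 2)

lemma cellSize_pos {τ : ℝ} (hτ : 0 < τ) {n : ℕ} (hn : 0 < n) : 0 < cellSize τ n := by
  have : (0 : ℝ) < n := by exact_mod_cast hn
  rw [cellSize]; positivity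

lemma natCast_mul_cellSize {τ : ℝ} {n : ℕ} (hn : 0 < n) :
    n * cellSize τ n = τ / (2 * n) := by
  have : (0 : ℝ) < n := by exact_mod_cast hn
  rw [cellSize]; field_simp

/-- The radius is `τ / n`, twice that of a return, because two points within `τ / (2n)` of `x` are
within `τ / n` of each other. -/
lemma ShortReturnBound.exists_bound (h : ShortReturnBound f μ) {τ : ℝ} (hτ : 0 < τ) :
    ∃ β : ℝ, 0 < β ∧ ∃ C > 0, ∀ᶠ n : ℕ in atTop, ∀ j, 1 ≤ j → j < logGap n →
      μ.real (closeReturnSet f j (τ / n)) ≤ C * (τ / n) ^ β := by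
  obtain ⟨β, hβ, C, hC, hev⟩ := h 1 (fun n => τ / n) one_pos (by
    -- The ratio to `n⁻¹` is constantly `τ`, so `c` must dominate `τ` and `τ⁻¹`; adding 1 ensures `c
    -- > 1`.
    refine ⟨max τ τ⁻¹ + 1, ?_, ?_⟩
    · have : 0 < max τ τ⁻¹ := lt_max_of_lt_left hτ
      linarith
    · filter_upwards [eventually_gt_atTop 0] with n hn
      have hn' : (0 : ℝ) < n := by exact_mod_cast hn
      have e : τ / n / (n : ℝ) ^ (-1 : ℝ) = τ := by
        rw [Real.rpow_neg_one]; field_simp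
      rw [e]
      constructor
      · rw [inv_le_comm₀ (by positivity) hτ]
        linarith [le_max_right τ τ⁻¹]
      · linarith [le_max_left τ τ⁻¹])
  exact ⟨β, hβ.1, C, hC, hev.mono fun n hn j hj hjg => hn j hj (le_sq_log_of_lt_logGap hjg)⟩

variable [IsProbabilityMeasure μ]

/-- Replacing the ball by a window changes its mass by two cells, of order `n⁻²`, which is
negligible after multiplication by `n`. -/
lemma IsLebesgueDensity.ae_tendsto_cells (hX : MeasurableSet X) (h : IsLebesgueDensity μ ρ)
    (hbv : IsBV ρ) {τ : ℝ} (hτ : 0 < τ) {w : ℕ → ℕ} (hw : ∀ n, w n ≤ n) (hw' : ∀ n, n ≤ w n + 1) :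
    ∀ᵐ x ∂μ, Tendsto (fun n : ℕ => n * μ.real {y | |cellIndex X (cellSize τ n) y
      - cellIndex X (cellSize τ n) x| ≤ w n}) atTop (𝓝 (τ * ρ x)) := by
  obtain ⟨K, hK0, hK⟩ := hbv.exists_bound
  filter_upwards [h.ae_tendsto_measureReal_div hX] with x hx
  have hr : Tendsto (fun n : ℕ => τ / (2 * (n : ℝ))) atTop (𝓝[>] 0) := by
    rw [tendsto_nhdsWithin_iff]
    constructor
    · have := tendsto_const_div_atTop_nhds_zero_nat (τ / 2)
      refine this.congr fun n => ?_
      rw [div_div]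
    · filter_upwards [eventually_gt_atTop 0] with n hn
      have : (0 : ℝ) < n := by exact_mod_cast hn
      exact Set.mem_Ioi.2 (by positivity)
  have hball : Tendsto (fun n : ℕ => n * μ.real {y | dist y x ≤ n * cellSize τ n}) atTop
      (𝓝 (τ * ρ x)) := by
    refine ((hx.comp hr).const_mul τ).congr' ?_
    filter_upwards [eventually_gt_atTop 0] with n hn
    have : (0 : ℝ) < n := by exact_mod_cast hn
    rw [natCast_mul_cellSize hn, Function.comp_apply]
    generalize μ.real _ = p
    field_simp
  have hdiff : Tendsto (fun n : ℕ => n * μ.real {y | |cellIndex X (cellSize τ n) y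
      - cellIndex X (cellSize τ n) x| ≤ w n} - n * μ.real {y | dist y x ≤ n * cellSize τ n})
      atTop (𝓝 0) := by
    have hz := tendsto_const_div_atTop_nhds_zero_nat (K * τ)
    refine squeeze_zero_norm' ?_ hz
    filter_upwards [eventually_gt_atTop 0] with n hn
    have hn' : (0 : ℝ) < n := by exact_mod_cast hn
    rw [← mul_sub, norm_mul, Real.norm_of_nonneg hn'.le, Real.norm_eq_abs]
    have := h.abs_measureReal_cells_sub_ball_le hX hK0 hK (cellSize_pos hτ hn) x (hw n) (hw' n)
    calc _ ≤ (n : ℝ) * (2 * (K * cellSize τ n)) := by gcongr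
      _ = _ := by rw [cellSize]; field_simp
  simpa using hdiff.add hball

lemma IsLebesgueDensity.tendsto_integral_cells (hX : MeasurableSet X) (h : IsLebesgueDensity μ ρ)
    (hbv : IsBV ρ) {τ : ℝ} (hτ : 0 < τ) {w : ℕ → ℕ} (hw : ∀ n, w n ≤ n) (hw' : ∀ n, n ≤ w n + 1)
    (m : ℕ) :
    Tendsto (fun n : ℕ => (n : ℝ) ^ m * ∫ x, μ.real {y | |cellIndex X (cellSize τ n) y
      - cellIndex X (cellSize τ n) x| ≤ w n} ^ m ∂μ) atTop (𝓝 (∫ x, (τ * ρ x) ^ m ∂μ)) := by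
  obtain ⟨K, hK0, hK⟩ := hbv.exists_bound
  simp_rw [← integral_const_mul, ← mul_pow]
  -- The dominating constant comes from `2 * w n + 1 ≤ 4 * n` and the cell length `τ / (2n²)`.
  refine tendsto_integral_filter_of_dominated_convergence (fun _ => (2 * K * τ) ^ m)
    (Eventually.of_forall fun n => ?_) ?_ (integrable_const _) ?_
  · have hmeas : Measurable fun x => ((n : ℝ) * μ.real {y | |cellIndex X (cellSize τ n) y
        - cellIndex X (cellSize τ n) x| ≤ w n}) ^ m :=
      (measurable_from_top (f := fun a : ℤ => ((n : ℝ) *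
        μ.real {y | |cellIndex X (cellSize τ n) y - a| ≤ w n}) ^ m)).comp measurable_cellIndex
    exact hmeas.aestronglyMeasurable
  · filter_upwards [eventually_gt_atTop 0] with n hn
    refine ae_of_all _ fun x => ?_
    have hn' : (1 : ℝ) ≤ n := by exact_mod_cast hn
    have hw1 : (w n : ℝ) ≤ n := by exact_mod_cast hw n
    rw [Real.norm_of_nonneg (by positivity)]
    refine pow_le_pow_left₀ (by positivity) ?_ m
    have hδ := cellSize_pos hτ hn
    have := h.measureReal_cells_le hX hK0 hK hδ (cellIndex X (cellSize τ n) x) (w n)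
    calc _ ≤ (n : ℝ) * (K * ((2 * w n + 1) * cellSize τ n)) := by gcongr
      _ ≤ (n : ℝ) * (K * ((4 * n) * cellSize τ n)) := by
          gcongr; linarith
      _ = _ := by rw [cellSize]; field_simp; ring
  · filter_upwards [h.ae_tendsto_cells hX hbv hτ hw hw'] with x hx
    exact hx.pow m

/-- The return event is sandwiched between the windows `n - 1` and `n`, whose rescaled integrals
have the same limit. The mixing error, of order `n ^ (m + 1) * exp (-θ * logGap n)`, vanishes. -/
lemma HyperbolicRecurrent.hasSeparatedAsymptotics (hX : MeasurableSet X)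
    (hf : HyperbolicRecurrent f μ ρ) {τ : ℝ} (hτ : 0 < τ) {m : ℕ} (hm : 1 ≤ m) :
    HasSeparatedAsymptotics μ (returnEvent f τ) logGap m (∫ x, (τ * ρ x) ^ m ∂μ) := by
  have hmp := hf.ergodic.toMeasurePreserving
  obtain ⟨C, hC, θ, hθ, hdec⟩ := hf.decay.exists_decorrelatesAfter hmp.measurable
  set I : ℕ → ℕ → ℝ := fun n w => ∫ x, μ.real {y | |cellIndex X (cellSize τ n) y
      - cellIndex X (cellSize τ n) x| ≤ w} ^ m ∂μ with hI
  set err : ℕ → ℝ := fun n => (n : ℝ) ^ m * ((m + 1) * (C * Real.exp (-θ * logGap n)) * (2 * n + 1))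
    with herr
  have herr0 : Tendsto err atTop (𝓝 0) := by
    have h1 := (tendsto_pow_mul_exp_neg_logGap hθ (m + 1)).const_mul (2 * (m + 1) * C)
    have h2 := (tendsto_pow_mul_exp_neg_logGap hθ m).const_mul ((m + 1) * C)
    have h3 := h1.add h2
    simp only [mul_zero, add_zero] at h3
    refine h3.congr fun n => ?_
    rw [herr, pow_succ]; ring
  have hlow : Tendsto (fun n : ℕ => (n : ℝ) ^ m * I n (n - 1) - err n) atTop
      (𝓝 (∫ x, (τ * ρ x) ^ m ∂μ)) := by
    simpa using (hf.density.tendsto_integral_cells hX hf.density_bv hτ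
      (w := fun n => n - 1) (fun n => Nat.sub_le _ _) (fun n => by omega) m).sub herr0
  have hup : Tendsto (fun n : ℕ => (n : ℝ) ^ m * I n n + err n) atTop
      (𝓝 (∫ x, (τ * ρ x) ^ m ∂μ)) := by
    simpa using (hf.density.tendsto_integral_cells hX hf.density_bv hτ
      (w := fun n => n) (fun n => le_rfl) (fun n => by omega) m).add herr0
  refine ⟨_, _, hlow, hup, ?_⟩
  filter_upwards [eventually_gt_atTop 0] with n hn s hc hsep hs
  have hn' : (0 : ℝ) < n := by exact_mod_cast hn
  have hδ := cellSize_pos hτ hn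
  have hne : s.Nonempty := Finset.card_pos.1 (by omega)
  have key := fun w => abs_measureReal_cell_returns_sub_integral_le (μ := μ) hmp
    (measurable_cellIndex (X := X) (δ := cellSize τ n))
    (η := C * Real.exp (-θ * logGap n)) (by positivity)
    (fun a b => hdec _ hδ _ a b) hne hsep hs w
  rw [hc] at key
  constructor
  · have h1 := (abs_le.1 (key (n - 1))).1
    have h2 : μ.real {x | ∀ j ∈ s, |cellIndex X (cellSize τ n) (f^[j] x)
        - cellIndex X (cellSize τ n) x| ≤ ((n - 1 : ℕ) : ℤ)}
        ≤ μ.real (allHit (returnEvent f τ n) s) := by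
      refine measureReal_mono fun x hx j hj => ?_
      have := dist_le_of_abs_cellIndex_sub_le hδ (hx j hj)
      rw [Nat.cast_sub (by omega : 1 ≤ n), Nat.cast_one, sub_add_cancel,
        natCast_mul_cellSize hn] at this
      exact this
    have h3 : (m + 1) * (C * Real.exp (-θ * logGap n)) * (2 * ((n - 1 : ℕ) : ℝ) + 1)
        ≤ (m + 1) * (C * Real.exp (-θ * logGap n)) * (2 * n + 1) := by
      gcongr; exact Nat.sub_le _ _
    rw [herr]
    dsimp only
    rw [← mul_sub]
    refine mul_le_mul_of_nonneg_left ?_ (by positivity)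
    linarith
  · have h1 := (abs_le.1 (key n)).2
    have h2 : μ.real (allHit (returnEvent f τ n) s)
        ≤ μ.real {x | ∀ j ∈ s, |cellIndex X (cellSize τ n) (f^[j] x)
          - cellIndex X (cellSize τ n) x| ≤ n} := by
      refine measureReal_mono fun x hx j hj => abs_cellIndex_sub_le_of_dist_le hδ ?_
      rw [natCast_mul_cellSize hn]
      exact hx j hj
    rw [herr]
    dsimp only
    rw [← mul_add]
    refine mul_le_mul_of_nonneg_left ?_ (by positivity)
    linarith

end Recurrence

/-! ### Close pairs, early returns and the conclusion -/

section Main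

variable {X : Set ℝ} {f : X → X} {μ : Measure X} {ρ : X → ℝ}

lemma returnEvent_subset_closeReturnSet {τ : ℝ} (hτ : 0 < τ) {n : ℕ} (hn : 0 < n) (j : ℕ) :
    returnEvent f τ n j ⊆ closeReturnSet f j (τ / n) := by
  intro x hx
  have hn' : (0 : ℝ) < n := by exact_mod_cast hn
  have h1 : dist (f^[j] x) x ≤ τ / (2 * n) := hx
  have h2 : τ / (2 * n) ≤ τ / n := by gcongr; linarith
  change dist x (f^[j] x) ≤ τ / n
  rw [dist_comm]
  exact h1.trans h2

/-- By the triangle inequality the second return is a short return of `f^[i] x` to itself. Keeping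
the first return as well gains the additional factor of order `1 / n`. -/
lemma returnEvent_inter_subset {τ : ℝ} {n : ℕ} (hn : 0 < n) (i l : ℕ) :
    returnEvent f τ n i ∩ returnEvent f τ n (i + l)
      ⊆ returnEvent f τ n i ∩ f^[i] ⁻¹' closeReturnSet f l (τ / n) := by
  rintro x ⟨h1, h2⟩
  refine ⟨h1, ?_⟩
  have hn' : (0 : ℝ) < n := by exact_mod_cast hn
  have h1' : dist (f^[i] x) x ≤ τ / (2 * n) := h1
  have h2' : dist (f^[i + l] x) x ≤ τ / (2 * n) := h2
  rw [add_comm i l, Function.iterate_add_apply] at h2'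
  change dist (f^[i] x) (f^[l] (f^[i] x)) ≤ τ / n
  refine (dist_triangle_right _ _ x).trans ((add_le_add h1' h2').trans (le_of_eq ?_))
  field_simp; norm_num

lemma recurrenceCount_eq_hitCount (τ : ℝ) (n : ℕ) (x : X) :
    recurrenceCount f n (τ / (2 * n)) x = hitCount (returnEvent f τ n) (Finset.Icc 1 n) x := by
  classical
  unfold recurrenceCount hitCount
  congr 1

lemma hitCount_Icc_eq_of_notMem {Ω : Type*} {U : ℕ → Set Ω} {g n : ℕ} (hg : 1 ≤ g) {x : Ω}
    (hx : x ∉ ⋃ j ∈ Finset.Ico 1 g, U j) :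
    hitCount U (Finset.Icc 1 n) x = hitCount U (Finset.Icc g n) x := by
  classical
  unfold hitCount
  congr 1
  ext j
  rw [Finset.mem_filter, Finset.mem_filter, Finset.mem_Icc, Finset.mem_Icc]
  refine ⟨fun ⟨⟨h1, h2⟩, h3⟩ => ⟨⟨?_, h2⟩, h3⟩, fun ⟨⟨h1, h2⟩, h3⟩ => ⟨⟨hg.trans h1, h2⟩, h3⟩⟩
  by_contra h
  exact hx (Set.mem_biUnion (x := j) (by simp; omega) h3)

variable [IsProbabilityMeasure μ]

lemma HyperbolicRecurrent.tendsto_integral_choose (hX : MeasurableSet X)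
    (hf : HyperbolicRecurrent f μ ρ) {τ : ℝ} (hτ : 0 < τ) {m : ℕ} (hm : 1 ≤ m) :
    Tendsto (fun n => ∫ x, ((hitCount (returnEvent f τ n) (Finset.Icc (logGap n) n) x).choose m : ℝ)
      ∂μ) atTop (𝓝 ((∫ x, (τ * ρ x) ^ m ∂μ) / m.factorial)) := by
  have hmp := hf.ergodic.toMeasurePreserving
  obtain ⟨C, hC, θ, hθ, hdec⟩ := hf.decay.exists_decorrelatesAfter hmp.measurable
  obtain ⟨K, hK0, hK⟩ := hf.density_bv.exists_bound
  obtain ⟨β, hβ, C', hC', hshort⟩ := hf.shortReturns.exists_bound hτ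
  set η : ℕ → ℝ := fun n => C * Real.exp (-θ * logGap n) with hη
  have hη0 : ∀ n, 0 ≤ η n := fun n => by positivity
  have hcs : ∀ n, 0 ≤ cellSize τ n := fun n => by rw [cellSize]; positivity
  -- Here `ε n` is of order `n^(-1-β)`. With `h n = n^(β/2)` the pair term is of order `logGap n *
  -- n^(-β/2)`, while `h` still outgrows every power of the gap.
  refine tendsto_integral_choose_hitCount
    (ε := fun n => (K * cellSize τ n + η n) * (2 * n + 1) * (C' * (τ / n) ^ β))
    (h := fun n => (n : ℝ) ^ (β / 2)) (Λ := fun m => ∫ x, (τ * ρ x) ^ m ∂μ)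
    (measurableSet_returnEvent hmp.measurable τ) one_le_logGap ?_
    (fun m hm => hf.hasSeparatedAsymptotics hX hτ hm) (fun n => ?_) ?_ ?_ ?_ ?_ hm
  · simpa using tendsto_logGap_pow_div_rpow 1 one_pos
  · have := hη0 n
    have := hcs n
    positivity
  · filter_upwards [eventually_gt_atTop 0] with n hn
    have : (0 : ℝ) < n := by exact_mod_cast hn
    positivity
  · filter_upwards [hshort, eventually_gt_atTop 0] with n hs hn i hi l hl hlg
    have hδ := cellSize_pos hτ hn
    have hmeas : MeasurableSet (closeReturnSet f l (τ / n)) :=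
      measurableSet_le (measurable_id.dist (hmp.measurable.iterate l)) measurable_const
    have hsub : returnEvent f τ n i ∩ returnEvent f τ n (i + l)
        ⊆ {x | |cellIndex X (cellSize τ n) (f^[i] x) - cellIndex X (cellSize τ n) x| ≤ n}
          ∩ f^[i] ⁻¹' closeReturnSet f l (τ / n) := by
      refine (returnEvent_inter_subset hn i l).trans (Set.inter_subset_inter_left _ fun x hx => ?_)
      refine abs_cellIndex_sub_le_of_dist_le hδ ?_
      rw [natCast_mul_cellSize hn]; exact hx
    have hcell := measureReal_cell_return_inter_le (μ := μ) hmp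
      (measurable_cellIndex (X := X) (δ := cellSize τ n)) (hη0 n)
      (fun a => by
        simpa only [Set.Icc_self, Set.mem_singleton_iff] using hdec _ hδ (logGap n) a a)
      (by positivity) (hf.density.measureReal_cell_le hX hK0 hK hδ)
      (Finset.mem_Icc.1 hi).1 n hmeas
    refine (measureReal_mono hsub).trans (hcell.trans ?_)
    have := hη0 n
    gcongr
    exact hs l hl hlg
  · have h1 : Tendsto (fun n : ℕ => (n : ℝ) * (2 * n + 1) * η n) atTop (𝓝 0) := by
      have e1 := (tendsto_pow_mul_exp_neg_logGap hθ 2).const_mul (2 * C)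
      have e2 := (tendsto_pow_mul_exp_neg_logGap hθ 1).const_mul C
      have := e1.add e2
      simp only [mul_zero, add_zero] at this
      refine this.congr fun n => ?_
      rw [hη]; ring
    have h2 : Tendsto (fun n : ℕ => K * τ + K * τ / 2 / n + (n : ℝ) * (2 * n + 1) * η n) atTop
        (𝓝 (K * τ)) := by
      have := (tendsto_const_nhds (x := K * τ)).add
        (tendsto_const_div_atTop_nhds_zero_nat (K * τ / 2)) |>.add h1
      simpa using this
    have h3 := (h2.mul (tendsto_logGap_pow_div_rpow 1 (by positivity : 0 < β / 2))).mul_const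
      (C' * τ ^ β)
    simp only [mul_zero, zero_mul] at h3
    refine h3.congr' ?_
    filter_upwards [eventually_gt_atTop 0] with n hn
    have hn' : (0 : ℝ) < n := by exact_mod_cast hn
    have hpow : (n : ℝ) ^ β = (n : ℝ) ^ (β / 2) * (n : ℝ) ^ (β / 2) := by
      rw [← Real.rpow_add hn']; ring_nf
    have hpos : (0 : ℝ) < (n : ℝ) ^ (β / 2) := by positivity
    rw [Real.div_rpow hτ.le hn'.le, hpow, cellSize, pow_one]
    generalize (n : ℝ) ^ (β / 2) = y at *
    field_simp
  · exact fun q => tendsto_logGap_pow_div_rpow q (by positivity)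

end Main

theorem mainTheorem1 (X : Set ℝ) (hX : MeasurableSet X) (f : X → X) (μ : Measure X) (ρ : X → ℝ)
    (hf : HyperbolicRecurrent f μ ρ) (τ : ℝ) (hτ : 0 < τ) (k : ℕ) (hk : 1 ≤ k) :
    Tendsto (fun n : ℕ => μ.real {x | recurrenceCount f n (τ / (2 * n)) x = k}) atTop
      (𝓝 (∫ x, τ ^ k * ρ x ^ (k + 1) / (k.factorial : ℝ) * Real.exp (-(ρ x * τ)) ∂lebesgueOn X)) := by
  have := hf.isProbabilityMeasure
  have hmp := hf.ergodic.toMeasurePreserving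
  have hU := measurableSet_returnEvent hmp.measurable τ
  obtain ⟨K, hK0, hK⟩ := hf.density_bv.exists_bound
  have hlate := tendsto_measureReal_eq_of_factorialMoments (μ := μ)
    (N := fun n => hitCount (returnEvent f τ n) (Finset.Icc (logGap n) n))
    (fun n => measurable_hitCount (hU n) _)
    (fun n m => integrable_comp_hitCount (hU n) _ fun N => (N.choose m : ℝ))
    (u := fun x => τ * ρ x) (hf.density.measurable.const_mul τ)
    (fun x => mul_nonneg hτ.le (hf.density.nonneg x)) (K := τ * K)
    (fun x => mul_le_mul_of_nonneg_left (hK x) hτ.le)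
    (fun m hm => hf.tendsto_integral_choose hX hτ hm) hk
  -- Integrating against `μ` rather than Lebesgue measure accounts for the exponent `k + 1` of the
  -- density.
  have htarget : ∫ x, (τ * ρ x) ^ k / k.factorial * Real.exp (-(τ * ρ x)) ∂μ
      = ∫ x, τ ^ k * ρ x ^ (k + 1) / (k.factorial : ℝ) * Real.exp (-(ρ x * τ)) ∂lebesgueOn X := by
    conv_lhs => rw [hf.density.eq_withDensity]
    rw [integral_withDensity_eq_integral_toReal_smul hf.density.measurable.ennreal_ofReal
      (ae_of_all _ fun x => ENNReal.ofReal_lt_top)]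
    refine integral_congr_ae (ae_of_all _ fun x => ?_)
    simp only [ENNReal.toReal_ofReal (hf.density.nonneg x), smul_eq_mul]
    rw [mul_comm τ (ρ x)]
    ring
  rw [← htarget]
  obtain ⟨β, hβ, C, hC, hshort⟩ := hf.shortReturns.exists_bound hτ
  have hearly : Tendsto (fun n : ℕ => (logGap n : ℝ) ^ 1 / (n : ℝ) ^ β * (C * τ ^ β)) atTop
      (𝓝 0) := by simpa using (tendsto_logGap_pow_div_rpow 1 hβ).mul_const (C * τ ^ β)
  -- The full and the late counts agree unless some return occurs before the gap, an event of
  -- measure at most `logGap n * C * (τ / n) ^ β`.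
  have hdiff : Tendsto (fun n : ℕ => μ.real {x | recurrenceCount f n (τ / (2 * n)) x = k}
      - μ.real {x | hitCount (returnEvent f τ n) (Finset.Icc (logGap n) n) x = k}) atTop
      (𝓝 0) := by
    refine squeeze_zero_norm' ?_ hearly
    filter_upwards [hshort, eventually_gt_atTop 0] with n hs hn
    set D : Set X := ⋃ j ∈ Finset.Ico 1 (logGap n), returnEvent f τ n j with hD
    have hμD : μ.real D ≤ (logGap n : ℝ) ^ 1 / (n : ℝ) ^ β * (C * τ ^ β) := by
      calc μ.real D ≤ ∑ j ∈ Finset.Ico 1 (logGap n), μ.real (returnEvent f τ n j) :=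
            measureReal_biUnion_finset_le _ _
        _ ≤ ∑ j ∈ Finset.Ico 1 (logGap n), C * (τ / n) ^ β := by
            refine Finset.sum_le_sum fun j hj => ?_
            obtain ⟨h1, h2⟩ := Finset.mem_Ico.1 hj
            exact (measureReal_mono (returnEvent_subset_closeReturnSet hτ hn j)).trans (hs j h1 h2)
        _ = ((logGap n - 1 : ℕ) : ℝ) * (C * (τ / n) ^ β) := by simp
        _ ≤ (logGap n : ℝ) * (C * (τ / n) ^ β) := by
            gcongr; exact Nat.sub_le _ _
        _ = _ := by
            rw [Real.div_rpow hτ.le (Nat.cast_nonneg n)]; ring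
    have hiff : ∀ x ∉ D, (recurrenceCount f n (τ / (2 * n)) x = k ↔
        hitCount (returnEvent f τ n) (Finset.Icc (logGap n) n) x = k) := fun x hx => by
      rw [recurrenceCount_eq_hitCount, hitCount_Icc_eq_of_notMem (one_le_logGap n) hx]
    have h1 := (measureReal_mono (μ := μ)
      (s₁ := {x | recurrenceCount f n (τ / (2 * n)) x = k})
      (s₂ := {x | hitCount (returnEvent f τ n) (Finset.Icc (logGap n) n) x = k} ∪ D)
      fun x hx => or_iff_not_imp_right.2 fun hxD => (hiff x hxD).1 hx).trans
      (measureReal_union_le _ _)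
    have h2 := (measureReal_mono (μ := μ)
      (s₁ := {x | hitCount (returnEvent f τ n) (Finset.Icc (logGap n) n) x = k})
      (s₂ := {x | recurrenceCount f n (τ / (2 * n)) x = k} ∪ D)
      fun x hx => or_iff_not_imp_right.2 fun hxD => (hiff x hxD).2 hx).trans
      (measureReal_union_le _ _)
    rw [Real.norm_eq_abs, abs_le]
    constructor <;> linarith
  simpa using hdiff.add hlate
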